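/- Fix $n\in\mathbb N$. A monotone circuit on $n$ bits is a finite directed acyclic graph of AND and OR gates of unbounded fan-in over the input bits $x_1,\dots,x_n$ (no negations), with one output node. Its size is its number of gates plus its number of wires, and its depth is the largest number of gates on a path from an input to the output. For $f:\{0,1\}^n\to\{0,1\}$ and a coalition $Q\subseteq[n]$, let $I_Q(f)$ be the probability that $f$ is not fixed after the bits indexed by $[n]\setminus Q$ are chosen uniformly at random; $f$ is $\rho$-tradeoff resilient if $I_Q(f)\le |Q|\rho$ for every $Q\subseteq[n]$. The bias of $f$ is $\left|\mathbb E_x[f(x)]-\tfrac12\right|$ for uniform $x\in\{0,1\}^n$. **Theorem.** There are a constant $c>0$ and a function $\varepsilon:\mathbb N\to\mathbb R$ with $\varepsilon(n)\to 0$ as $n\to\infty$ such that for infinitely many $n$ there exists a monotone circuit $C$ on $n$ bits, of depth $3$ and size at most $n^{c}$, which is $\left(\frac{c\log^{2}n}{n}\right)$-tradeoff resilient and has bias at most $n^{-1+\varepsilon(n)}$. -/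

import Mathlib

/-- The two kinds of gates of a monotone circuit (there are no negations). -/
inductive GateKind where
  | and
  | or

/-- A monotone Boolean circuit on `n` input bits: a finite directed acyclic graph whose nodes are
the input bits (`Sum.inl i`) and AND / OR gates (`Sum.inr g`) of unbounded fan-in and fan-out.
Acyclicity is the well-foundedness of the relation "there is a wire from `p` into `q`", which for
a finite graph is the absence of directed cycles. -/
structure MonotoneCircuit (n : ℕ) where
  Gate : Type
  fintypeGate : Fintype Gate
  kind : Gate → GateKind
  /-- the nodes that are wired into a gate -/
  inputs : Gate → Finset (Fin n ⊕ Gate)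
  acyclic : WellFounded fun p q : Fin n ⊕ Gate => ∃ g, q = Sum.inr g ∧ p ∈ inputs g
  output : Fin n ⊕ Gate

namespace MonotoneCircuit

variable {n : ℕ}

/-- The bit computed at a node on input `x`: an AND gate outputs the minimum of its inputs in
`Bool` (where `false < true`), an OR gate their maximum. -/
noncomputable def value (C : MonotoneCircuit n) (x : Fin n → Bool) : Fin n ⊕ C.Gate → Bool
  | Sum.inl i => x i
  | Sum.inr g =>
    match C.kind g with
    | GateKind.and => (C.inputs g).attach.inf fun p => C.value x p.1
    | GateKind.or => (C.inputs g).attach.sup fun p => C.value x p.1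
termination_by p => C.acyclic.wrap p
decreasing_by all_goals exact ⟨g, rfl, p.2⟩

theorem value_inl (C : MonotoneCircuit n) (x : Fin n → Bool) (i : Fin n) :
    C.value x (Sum.inl i) = x i := by
  rw [value]

theorem value_and (C : MonotoneCircuit n) (x : Fin n → Bool) (g : C.Gate)
    (h : C.kind g = GateKind.and) :
    C.value x (Sum.inr g) = true ↔ ∀ p ∈ C.inputs g, C.value x p = true := by
  rw [value, h]
  refine (Finset.inf_eq_top_iff _ _).trans ?_
  exact ⟨fun H p hp => H ⟨p, hp⟩ (Finset.mem_attach _ _), fun H p _ => H p.1 p.2⟩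

theorem value_or (C : MonotoneCircuit n) (x : Fin n → Bool) (g : C.Gate)
    (h : C.kind g = GateKind.or) :
    C.value x (Sum.inr g) = true ↔ ∃ p ∈ C.inputs g, C.value x p = true := by
  rw [value, h, ← not_iff_not, Bool.not_eq_true]
  refine (Finset.sup_eq_bot_iff _ _).trans ?_
  simp only [not_exists, not_and, Bool.not_eq_true]
  exact ⟨fun H p hp => H ⟨p, hp⟩ (Finset.mem_attach _ _), fun H p _ => H p.1 p.2⟩

/-- The depth of a node: input bits have depth `0`, and a gate is one deeper than the deepest of
its inputs. -/
noncomputable def nodeDepth (C : MonotoneCircuit n) : Fin n ⊕ C.Gate → ℕ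
  | Sum.inl _ => 0
  | Sum.inr g => ((C.inputs g).attach.sup fun p => C.nodeDepth p.1) + 1
termination_by p => C.acyclic.wrap p
decreasing_by exact ⟨g, rfl, p.2⟩

/-- The function `{0,1}ⁿ → {0,1}` computed by the circuit. -/
noncomputable def eval (C : MonotoneCircuit n) (x : Fin n → Bool) : Bool :=
  C.value x C.output

/-- The depth of the circuit: the number of gates on a longest path from an input to the output. -/
noncomputable def depth (C : MonotoneCircuit n) : ℕ :=
  C.nodeDepth C.output

/-- The size of the circuit: the number of its gates plus the number of its wires. -/
def size (C : MonotoneCircuit n) : ℕ :=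
  letI := C.fintypeGate
  Fintype.card C.Gate + ∑ g : C.Gate, (C.inputs g).card

end MonotoneCircuit

open Classical in
/-- The probability of the event `P` over a uniformly random `x ∈ {0,1}ⁿ`. -/
noncomputable def uniformProb {n : ℕ} (P : (Fin n → Bool) → Prop) : ℝ :=
  ((Finset.univ.filter P).card : ℝ) / 2 ^ n

/-- `f` is not fixed once the bits of `x` outside the coalition `Q` are set (the bits of `x`
in `Q` play no role): two completions of these bits have different values under `f`. -/
def NotFixed {n : ℕ} (f : (Fin n → Bool) → Bool) (Q : Finset (Fin n)) (x : Fin n → Bool) : Prop :=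
  ∃ y z : Fin n → Bool, (∀ i, i ∉ Q → y i = x i) ∧ (∀ i, i ∉ Q → z i = x i) ∧ f y ≠ f z

/-- The influence `I_Q(f)` of the coalition `Q` under the uniform distribution. -/
noncomputable def influence {n : ℕ} (f : (Fin n → Bool) → Bool) (Q : Finset (Fin n)) : ℝ :=
  uniformProb (NotFixed f Q)

/-- `f` is `ρ`-tradeoff resilient (under the uniform distribution). -/
def TradeoffResilient {n : ℕ} (ρ : ℝ) (f : (Fin n → Bool) → Bool) : Prop :=
  ∀ Q : Finset (Fin n), influence f Q ≤ (Q.card : ℝ) * ρ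

/-- The bias `|E[f] - 1/2|` of `f` under the uniform distribution. -/
noncomputable def bias {n : ℕ} (f : (Fin n → Bool) → Bool) : ℝ :=
  |uniformProb (fun x => f x = true) - 1 / 2|

/-- The tribes function of a partition of the `n` bits into `b` blocks of width `w`: some block
consists of ones only. -/
def Tribe {b w n : ℕ} (e : Fin b × Fin w ≃ Fin n) (x : Fin n → Bool) : Prop :=
  ∃ β, ∀ j, x (e (β, j)) = true

/-- The number of ones of `x`. -/
def onesCount {n : ℕ} (x : Fin n → Bool) : ℕ := (Finset.univ.filter fun i => x i = true).card

/-- The probability of `x` under independent bits that equal one with probability `p`. -/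
noncomputable def biasedWeight {n : ℕ} (p : ℝ) (x : Fin n → Bool) : ℝ :=
  ∏ i, if x i = true then p else 1 - p

open Classical in
/-- The fraction of the layouts whose tribes function vanishes at `x`. -/
noncomputable def missFraction (b w : ℕ) {n : ℕ} (x : Fin n → Bool) : ℝ :=
  ((Finset.univ.filter fun e : Fin b × Fin w ≃ Fin n => ¬ Tribe e x).card : ℝ) /
    Fintype.card (Fin b × Fin w ≃ Fin n)

theorem sum_prod_coords {ι R : Type*} [Fintype ι] [DecidableEq ι] [CommSemiring R]
    (F : ι → Bool → R) :
    ∑ x : ι → Bool, ∏ i, F i (x i) = ∏ i, (F i true + F i false) := by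
  have h := (Finset.prod_univ_sum (fun _ : ι => (Finset.univ : Finset Bool)) F).symm
  rw [Fintype.piFinset_univ] at h
  rw [h]
  exact Finset.prod_congr rfl fun i _ => Fintype.sum_bool _

theorem sum_prod_blocks {R : Type*} [CommSemiring R] {b w n : ℕ} (e : Fin b × Fin w ≃ Fin n)
    (F : Fin b → (Fin w → Bool) → R) :
    ∑ x : Fin n → Bool, ∏ β, F β (fun j => x (e (β, j))) = ∏ β, ∑ v, F β v := by
  have h := (Finset.prod_univ_sum (fun _ : Fin b => (Finset.univ : Finset (Fin w → Bool))) F).symm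
  rw [Fintype.piFinset_univ] at h
  rw [← h]
  refine Fintype.sum_equiv ((e.symm.arrowCongr (Equiv.refl Bool)).trans
    (Equiv.curry (Fin b) (Fin w) Bool)) _ _ fun x => ?_
  rfl

theorem prod_eq_prod_blocks {R : Type*} [CommMonoid R] {b w n : ℕ} (e : Fin b × Fin w ≃ Fin n)
    (F : Fin n → R) : ∏ i, F i = ∏ β, ∏ j, F (e (β, j)) := by
  rw [← Equiv.prod_comp e, Fintype.prod_prod_type]

theorem uniformProb_eq_sum {n : ℕ} (P : (Fin n → Bool) → Prop) [DecidablePred P] :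
    uniformProb P = ∑ x, if P x then ((1 : ℝ) / 2) ^ n else 0 := by
  rw [uniformProb, ← Finset.sum_filter, Finset.sum_const, nsmul_eq_mul, one_div, inv_pow,
    div_eq_mul_inv]
  congr!

theorem uniformProb_mono {n : ℕ} {P R : (Fin n → Bool) → Prop} (h : ∀ x, P x → R x) :
    uniformProb P ≤ uniformProb R := by
  classical
  rw [uniformProb, uniformProb]
  gcongr
  exact h _

theorem uniformProb_nonneg {n : ℕ} (P : (Fin n → Bool) → Prop) : 0 ≤ uniformProb P := by
  rw [uniformProb]; positivity

theorem uniformProb_true {n : ℕ} : uniformProb (fun _ : Fin n → Bool => True) = 1 := by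
  simp [uniformProb]

theorem uniformProb_le_one {n : ℕ} (P : (Fin n → Bool) → Prop) : uniformProb P ≤ 1 :=
  (uniformProb_mono fun _ _ => trivial).trans_eq uniformProb_true

theorem uniformProb_exists_le {n : ℕ} {ι : Type*} (s : Finset ι)
    (P : ι → (Fin n → Bool) → Prop) :
    uniformProb (fun x => ∃ i ∈ s, P i x) ≤ ∑ i ∈ s, uniformProb (P i) := by
  classical
  simp only [uniformProb, ← Finset.sum_div]
  gcongr
  have : (Finset.univ.filter fun x => ∃ i ∈ s, P i x)
      = s.biUnion fun i => Finset.univ.filter (P i) := by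
    ext x; simp
  have h2 := (congrArg Finset.card this).trans_le Finset.card_biUnion_le
  rw [← Nat.cast_sum]
  refine Nat.cast_le.2 (le_trans (le_of_eq ?_) h2)
  congr!

theorem biasedWeight_nonneg {n : ℕ} {p : ℝ} (h0 : 0 ≤ p) (h1 : p ≤ 1) (x : Fin n → Bool) :
    0 ≤ biasedWeight p x :=
  Finset.prod_nonneg fun i _ => by split_ifs <;> linarith

theorem sum_biasedWeight {n : ℕ} (p : ℝ) : ∑ x : Fin n → Bool, biasedWeight p x = 1 := by
  simp only [biasedWeight]
  rw [sum_prod_coords (fun _ c => if c = true then p else 1 - p)]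
  simp

theorem biasedWeight_half {n : ℕ} (x : Fin n → Bool) : biasedWeight (1 / 2) x = (1 / 2) ^ n := by
  rw [biasedWeight, Finset.prod_congr rfl (g := fun _ => (1 / 2 : ℝ))]
  · simp
  · intro i _; split_ifs <;> norm_num

theorem onesCount_le {n : ℕ} (x : Fin n → Bool) : onesCount x ≤ n :=
  (Finset.card_filter_le _ _).trans_eq (by simp)

theorem prod_ite_eq_pow_onesCount {n : ℕ} (a c : ℝ) (x : Fin n → Bool) :
    (∏ i, if x i = true then a else c) = a ^ onesCount x * c ^ (n - onesCount x) := by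
  rw [Finset.prod_ite, Finset.prod_const, Finset.prod_const, onesCount]
  congr 2
  have := Finset.card_filter_add_card_filter_not (s := (Finset.univ : Finset (Fin n)))
    (fun i => x i = true)
  simp only [Finset.card_univ, Fintype.card_fin] at this
  omega

open Classical in
theorem sum_biasedWeight_not_tribe {b w n : ℕ} (p : ℝ) (e : Fin b × Fin w ≃ Fin n) :
    ∑ x, (if Tribe e x then 0 else biasedWeight p x) = (1 - p ^ w) ^ b := by
  have h : ∀ x : Fin n → Bool, (if Tribe e x then 0 else biasedWeight p x) =
      ∏ β, (fun v : Fin w → Bool => if ∀ j, v j = true then 0 else biasedWeight p v)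
        (fun j => x (e (β, j))) := by
    intro x
    by_cases hx : Tribe e x
    · obtain ⟨β, hβ⟩ := hx
      rw [if_pos ⟨β, hβ⟩]
      exact (Finset.prod_eq_zero (Finset.mem_univ β) (by simp [hβ])).symm
    · rw [if_neg hx, biasedWeight, prod_eq_prod_blocks e]
      refine Finset.prod_congr rfl fun β _ => ?_
      have : ¬ ∀ j, x (e (β, j)) = true := fun hh => hx ⟨β, hh⟩
      simp only [if_neg this]
      rfl
  rw [Finset.sum_congr rfl fun x _ => h x,
    sum_prod_blocks e (fun _ v => if ∀ j, v j = true then 0 else biasedWeight p v)]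
  rw [Finset.prod_const, Finset.card_univ, Fintype.card_fin]
  congr 1
  have h2 : ∀ v : Fin w → Bool, (if ∀ j, v j = true then 0 else biasedWeight p v) =
      biasedWeight p v - if v = (fun _ => true) then p ^ w else 0 := by
    intro v
    by_cases hv : ∀ j, v j = true
    · have : v = fun _ => true := funext hv
      subst this
      simp [biasedWeight]
    · have : v ≠ fun _ => true := fun hh => hv fun j => by rw [hh]
      simp [hv, this]
  rw [Finset.sum_congr rfl fun v _ => h2 v, Finset.sum_sub_distrib, sum_biasedWeight]
  simp

theorem uniformProb_not_tribe {b w n : ℕ} (e : Fin b × Fin w ≃ Fin n) :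
    uniformProb (fun x => ¬ Tribe e x) = (1 - (1 / 2) ^ w) ^ b := by
  classical
  have h := sum_biasedWeight_not_tribe (1 / 2) e
  rw [← h, uniformProb_eq_sum]
  refine Finset.sum_congr rfl fun x _ => ?_
  rw [biasedWeight_half]
  split_ifs <;> simp_all

theorem missFraction_nonneg (b w : ℕ) {n : ℕ} (x : Fin n → Bool) : 0 ≤ missFraction b w x := by
  rw [missFraction]; positivity

theorem missFraction_le_one (b w : ℕ) {n : ℕ} (x : Fin n → Bool) : missFraction b w x ≤ 1 := by
  rw [missFraction]
  refine div_le_one_of_le₀ ?_ (by positivity)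
  exact_mod_cast Finset.card_le_univ _

theorem exists_perm_of_onesCount_le {n : ℕ} {x y : Fin n → Bool}
    (h : onesCount x ≤ onesCount y) :
    ∃ σ : Equiv.Perm (Fin n), ∀ i, x i = true → y (σ i) = true := by
  classical
  obtain ⟨t, ht, hc⟩ := Finset.exists_subset_card_eq h
  let f : {i // x i = true} ≃ {i // i ∈ t} := Fintype.equivOfCardEq (by
    rw [Fintype.card_coe, hc, Fintype.card_subtype]; rfl)
  refine ⟨f.extendSubtype, fun i hi => ?_⟩
  have := f.extendSubtype_mem i hi
  exact (Finset.mem_filter.1 (ht this)).2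

theorem missFraction_anti {b w n : ℕ} {x y : Fin n → Bool} (h : onesCount x ≤ onesCount y) :
    missFraction b w y ≤ missFraction b w x := by
  classical
  obtain ⟨σ, hσ⟩ := exists_perm_of_onesCount_le h
  rw [missFraction, missFraction]
  gcongr ?_ / _
  norm_cast
  refine Finset.card_le_card_of_injOn (fun e => e.trans σ.symm) ?_ ?_
  · intro e he
    simp only [Finset.coe_filter, Finset.mem_univ, true_and, Set.mem_ofPred_eq] at he ⊢
    rintro ⟨β, hβ⟩
    refine he ⟨β, fun j => ?_⟩
    simpa using hσ _ (hβ j)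
  · intro e _ e' _ hee
    ext i
    have := congrArg (fun g : Fin b × Fin w ≃ Fin n => σ (g i)) hee
    simpa using congrArg Fin.val this

open Classical in
theorem sum_biasedWeight_mul_missFraction {b w n : ℕ} (p : ℝ) (e₀ : Fin b × Fin w ≃ Fin n) :
    ∑ y : Fin n → Bool, biasedWeight p y * missFraction b w y = (1 - p ^ w) ^ b := by
  have hpos : (0 : ℝ) < Fintype.card (Fin b × Fin w ≃ Fin n) := by
    have : Nonempty (Fin b × Fin w ≃ Fin n) := ⟨e₀⟩
    exact_mod_cast Fintype.card_pos
  have h : ∀ y : Fin n → Bool, biasedWeight p y * missFraction b w y =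
      (∑ e : Fin b × Fin w ≃ Fin n, if Tribe e y then 0 else biasedWeight p y) /
        Fintype.card (Fin b × Fin w ≃ Fin n) := by
    intro y
    rw [missFraction, ← mul_div_assoc]
    congr 1
    simp_rw [← ite_not (Tribe _ y)]
    rw [← Finset.sum_filter, Finset.sum_const, nsmul_eq_mul, mul_comm]
  rw [Finset.sum_congr rfl fun y _ => h y, ← Finset.sum_div, Finset.sum_comm,
    Finset.sum_congr rfl fun e _ => sum_biasedWeight_not_tribe p e, Finset.sum_const,
    nsmul_eq_mul, Finset.card_univ]
  field_simp

open Classical in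
theorem le_missFraction_add {b w n : ℕ} {p κ : ℝ} (h0 : 0 ≤ p) (h1 : p ≤ 1)
    (e₀ : Fin b × Fin w ≃ Fin n) {x : Fin n → Bool} (hx : (onesCount x : ℝ) ≤ κ) :
    (1 - p ^ w) ^ b ≤ missFraction b w x +
      ∑ y : Fin n → Bool, if (onesCount y : ℝ) ≤ κ then biasedWeight p y else 0 := by
  rw [← sum_biasedWeight_mul_missFraction p e₀]
  calc ∑ y : Fin n → Bool, biasedWeight p y * missFraction b w y
      ≤ ∑ y : Fin n → Bool, (biasedWeight p y * missFraction b w x +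
          if (onesCount y : ℝ) ≤ κ then biasedWeight p y else 0) := by
        refine Finset.sum_le_sum fun y _ => ?_
        have hw := biasedWeight_nonneg h0 h1 y
        have hx0 := missFraction_nonneg b w x
        split_ifs with hy
        · nlinarith [missFraction_le_one b w y, mul_nonneg hw hx0]
        · have : onesCount x ≤ onesCount y := by
            have : (onesCount x : ℝ) < onesCount y := by linarith
            exact_mod_cast this.le
          rw [add_zero]
          exact mul_le_mul_of_nonneg_left (missFraction_anti this) hw
    _ = _ := by
        rw [Finset.sum_add_distrib, ← Finset.sum_mul, sum_biasedWeight, one_mul]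

theorem one_sub_le_exp_quadratic {x : ℝ} (h0 : 0 ≤ x) (h1 : x < 1) :
    1 - x ≤ Real.exp (-x - x ^ 2 / 2) := by
  have h := Real.hasSum_pow_div_log_of_abs_lt_one (x := x) (by rwa [abs_of_nonneg h0])
  have h2 := sum_le_hasSum (Finset.range 2) (fun i _ => by positivity) h
  rw [← Real.log_le_iff_le_exp (by linarith)]
  norm_num [Finset.sum_range_succ] at h2
  linarith

theorem biasedWeight_le {n : ℕ} {s : ℝ} (h0 : 0 ≤ s) (h1 : s < 1 / 2) {y : Fin n → Bool}
    (hy : (onesCount y : ℝ) ≤ n / 2 + s * n / 8) :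
    biasedWeight (1 / 2 + s) y ≤ (1 / 2) ^ n * Real.exp (-(s ^ 2 * n / 4)) := by
  have hk := onesCount_le y
  rw [biasedWeight, prod_ite_eq_pow_onesCount]
  set k := onesCount y
  have e1 : (1 / 2 + s : ℝ) ≤ 1 / 2 * Real.exp (2 * s) := by
    linarith [Real.add_one_le_exp (2 * s)]
  have e2 : (1 - (1 / 2 + s) : ℝ) ≤ 1 / 2 * Real.exp (-(2 * s) - (2 * s) ^ 2 / 2) := by
    linarith [one_sub_le_exp_quadratic (x := 2 * s) (by linarith) (by linarith)]
  calc (1 / 2 + s) ^ k * (1 - (1 / 2 + s)) ^ (n - k)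
      ≤ (1 / 2 * Real.exp (2 * s)) ^ k *
          (1 / 2 * Real.exp (-(2 * s) - (2 * s) ^ 2 / 2)) ^ (n - k) := by
        gcongr
        · exact pow_nonneg (by linarith) _
        · linarith
    _ = (1 / 2) ^ n * Real.exp (k * (2 * s) + (n - k : ℝ) * (-(2 * s) - (2 * s) ^ 2 / 2)) := by
        rw [mul_pow, mul_pow, ← Real.exp_nat_mul, ← Real.exp_nat_mul, Real.exp_add,
          Nat.cast_sub hk, show ((1 : ℝ) / 2) ^ n = (1 / 2) ^ k * (1 / 2) ^ (n - k) by
            rw [← pow_add, Nat.add_sub_cancel' hk]]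
        ring
    _ ≤ _ := by
        gcongr
        have hn : (0 : ℝ) ≤ n := by positivity
        have hd : 0 ≤ (n / 2 + s * n / 8 - k : ℝ) := by linarith
        nlinarith [mul_nonneg h0 hd, mul_nonneg (mul_nonneg h0 h0) hd,
          mul_nonneg (mul_nonneg (mul_nonneg h0 h0) hn) (show 0 ≤ 1 - s by linarith)]

open Classical in
theorem sum_biasedWeight_lower_tail_le {n : ℕ} {s : ℝ} (h0 : 0 ≤ s) (h1 : s < 1 / 2) :
    (∑ y : Fin n → Bool, if (onesCount y : ℝ) ≤ n / 2 + s * n / 8 then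
      biasedWeight (1 / 2 + s) y else 0) ≤ Real.exp (-(s ^ 2 * n / 4)) := by
  calc _ ≤ ∑ _y : Fin n → Bool, (1 / 2 : ℝ) ^ n * Real.exp (-(s ^ 2 * n / 4)) := by
        refine Finset.sum_le_sum fun y _ => ?_
        split_ifs with hy
        · exact biasedWeight_le h0 h1 hy
        · positivity
    _ = _ := by
        rw [Finset.sum_const, nsmul_eq_mul, ← mul_assoc]
        simp

theorem uniformProb_onesCount_gt_le {n : ℕ} {s : ℝ} (h0 : 0 ≤ s) :
    uniformProb (fun x : Fin n → Bool => (n : ℝ) / 2 + s * n / 8 < onesCount x) ≤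
      Real.exp (-(s ^ 2 * n / 32)) := by
  classical
  rw [uniformProb_eq_sum]
  have key : ∀ x : Fin n → Bool,
      (if (n : ℝ) / 2 + s * n / 8 < onesCount x then ((1 : ℝ) / 2) ^ n else 0) ≤
      Real.exp (-(s ^ 2 * n / 16)) * ∏ i, (fun (_ : Fin n) c => if c = true then
        1 / 2 * Real.exp (s / 4) else 1 / 2 * Real.exp (-(s / 4))) i (x i) := by
    intro x
    have hk := onesCount_le x
    dsimp only
    rw [prod_ite_eq_pow_onesCount]
    split_ifs with hx
    · set k := onesCount x
      rw [mul_pow, mul_pow, ← Real.exp_nat_mul, ← Real.exp_nat_mul, Nat.cast_sub hk]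
      calc ((1 : ℝ) / 2) ^ n = (1 / 2) ^ n * 1 := by ring
        _ ≤ (1 / 2) ^ n * Real.exp (-(s ^ 2 * n / 16) +
              (k * (s / 4) + (n - k : ℝ) * (-(s / 4)))) := by
            gcongr
            refine Real.one_le_exp ?_
            nlinarith
        _ = _ := by
          rw [Real.exp_add, Real.exp_add,
            show ((1 : ℝ) / 2) ^ n = (1 / 2) ^ k * (1 / 2) ^ (n - k) by
            rw [← pow_add, Nat.add_sub_cancel' hk]]
          ring
    · positivity
  refine (Finset.sum_le_sum fun x _ => key x).trans ?_
  rw [← Finset.mul_sum, sum_prod_coords (fun (_ : Fin n) c => if c = true then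
    1 / 2 * Real.exp (s / 4) else 1 / 2 * Real.exp (-(s / 4)))]
  have hc : 1 / 2 * Real.exp (s / 4) + 1 / 2 * Real.exp (-(s / 4)) ≤
      Real.exp ((s / 4) ^ 2 / 2) := by
    have := Real.cosh_le_exp_half_sq (s / 4)
    rw [Real.cosh_eq] at this
    linarith
  simp only [if_true, Bool.false_eq_true, if_false, Finset.prod_const, Finset.card_univ,
    Fintype.card_fin]
  calc _ ≤ Real.exp (-(s ^ 2 * n / 16)) * Real.exp ((s / 4) ^ 2 / 2) ^ n := by gcongr
    _ = _ := by
      rw [← Real.exp_nat_mul, ← Real.exp_add]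
      congr 1
      ring

open Classical in
/-- The number of bits of `Q` in the block `β`. -/
noncomputable def blockCount {b w n : ℕ} (e : Fin b × Fin w ≃ Fin n) (Q : Finset (Fin n))
    (β : Fin b) : ℕ := (Finset.univ.filter fun j => e (β, j) ∈ Q).card

/-- The total exponential load that `Q` puts on the blocks of a layout. -/
noncomputable def load {b w n : ℕ} (e : Fin b × Fin w ≃ Fin n) (Q : Finset (Fin n)) : ℝ :=
  ∑ β, ((2 : ℝ) ^ blockCount e Q β - 1)

/-- The blocks of a layout that meet `Q`. -/
def touched {b w n : ℕ} (e : Fin b × Fin w ≃ Fin n) (Q : Finset (Fin n)) : Finset (Fin b) :=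
  Q.image fun i => (e.symm i).1

theorem mem_touched {b w n : ℕ} {e : Fin b × Fin w ≃ Fin n} {Q : Finset (Fin n)} {β : Fin b} :
    β ∈ touched e Q ↔ ∃ j, e (β, j) ∈ Q := by
  simp only [touched, Finset.mem_image]
  constructor
  · rintro ⟨i, hi, rfl⟩
    exact ⟨(e.symm i).2, by simpa using hi⟩
  · rintro ⟨j, hj⟩
    exact ⟨_, hj, by simp⟩

theorem card_touched_le {b w n : ℕ} (e : Fin b × Fin w ≃ Fin n) (Q : Finset (Fin n)) :
    (touched e Q).card ≤ Q.card := Finset.card_image_le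

/-- At `x`, the coalition `Q` controls the tribes function of the layout `e`: the bits outside `Q`
complete some block that meets `Q`, but no block disjoint from `Q`. -/
def Controls {b w n : ℕ} (e : Fin b × Fin w ≃ Fin n) (Q : Finset (Fin n)) (x : Fin n → Bool) :
    Prop :=
  ∃ β ∈ touched e Q, (∀ j, e (β, j) ∉ Q → x (e (β, j)) = true) ∧
    ∀ γ, γ ∉ touched e Q → ∃ j, x (e (γ, j)) = false

theorem controls_of_ne {b w n M : ℕ} (e : Fin M → (Fin b × Fin w ≃ Fin n)) {Q : Finset (Fin n)}
    {x y z : Fin n → Bool} (hy : ∀ i, i ∉ Q → y i = x i) (hz : ∀ i, i ∉ Q → z i = x i)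
    (hfy : ∀ i, Tribe (e i) y) (hfz : ¬ ∀ i, Tribe (e i) z) : ∃ i, Controls (e i) Q x := by
  push Not at hfz
  obtain ⟨i, hi⟩ := hfz
  obtain ⟨β, hβ⟩ := hfy i
  simp only [Tribe, not_exists, not_forall, Bool.not_eq_true] at hi
  have hun : ∀ γ, γ ∉ touched (e i) Q → ∃ j, x (e i (γ, j)) = false := by
    intro γ hγ
    obtain ⟨j, hj⟩ := hi γ
    refine ⟨j, ?_⟩
    rw [← hz _ fun h => hγ (mem_touched.2 ⟨j, h⟩), hj]
  have hx : ∀ j, e i (β, j) ∉ Q → x (e i (β, j)) = true := fun j hj => by rw [← hy _ hj, hβ]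
  refine ⟨i, β, ?_, hx, hun⟩
  by_contra h
  obtain ⟨j, hj⟩ := hun β h
  rw [hx j fun h' => h (mem_touched.2 ⟨j, h'⟩)] at hj
  cases hj

theorem sum_cylinder {w : ℕ} (S : Finset (Fin w)) :
    (∑ v : Fin w → Bool, if ∀ j, j ∉ S → v j = true then ((1 : ℝ) / 2) ^ w else 0) =
      (1 / 2) ^ w * 2 ^ S.card := by
  have h : ∀ v : Fin w → Bool, (if ∀ j, j ∉ S → v j = true then ((1 : ℝ) / 2) ^ w else 0) =
      (1 / 2) ^ w * ∏ j, (fun j c => if j ∉ S → c = true then (1 : ℝ) else 0) j (v j) := by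
    intro v
    split_ifs with hv
    · rw [Finset.prod_eq_one fun j _ => by simp only [if_pos (hv j)], mul_one]
    · push Not at hv
      obtain ⟨j, hj, hj2⟩ := hv
      rw [Finset.prod_eq_zero (Finset.mem_univ j), mul_zero]
      simp [hj, hj2]
  rw [Finset.sum_congr rfl fun v _ => h v, ← Finset.mul_sum,
    sum_prod_coords (fun j c => if j ∉ S → c = true then (1 : ℝ) else 0)]
  congr 1
  rw [← Finset.prod_const, ← Finset.prod_subset (Finset.subset_univ S)]
  · refine Finset.prod_congr rfl fun j hj => ?_
    simp [hj]; norm_num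
  · intro j _ hj
    simp [hj]

theorem uniformProb_controls_block {b w n : ℕ} (hn : n = b * w) (e : Fin b × Fin w ≃ Fin n)
    (Q : Finset (Fin n)) {β : Fin b} (hβ : β ∈ touched e Q) :
    uniformProb (fun x => (∀ j, e (β, j) ∉ Q → x (e (β, j)) = true) ∧
      ∀ γ, γ ∉ touched e Q → ∃ j, x (e (γ, j)) = false) =
    (1 / 2) ^ w * 2 ^ blockCount e Q β * (1 - (1 / 2) ^ w) ^ (b - (touched e Q).card) := by
  classical
  rw [uniformProb_eq_sum]
  let F : Fin b → (Fin w → Bool) → ℝ := fun γ v =>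
    if γ = β then (if ∀ j, j ∉ (Finset.univ.filter fun j => e (β, j) ∈ Q) → v j = true then
      (1 / 2) ^ w else 0)
    else if γ ∈ touched e Q then (1 / 2) ^ w
    else if ∀ j, v j = true then 0 else (1 / 2) ^ w
  have hF : ∀ x : Fin n → Bool, (if (∀ j, e (β, j) ∉ Q → x (e (β, j)) = true) ∧
      ∀ γ, γ ∉ touched e Q → ∃ j, x (e (γ, j)) = false then ((1 : ℝ) / 2) ^ n else 0) =
      ∏ γ, F γ fun j => x (e (γ, j)) := by
    intro x
    split_ifs with hx
    · rw [Finset.prod_congr rfl (g := fun _ => ((1 : ℝ) / 2) ^ w)]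
      · rw [Finset.prod_const, Finset.card_univ, Fintype.card_fin, ← pow_mul, hn, mul_comm]
      · intro γ _
        simp only [F]
        split_ifs with h1 h2 h3 h4
        · rfl
        · subst h1
          exact absurd (fun j hj => hx.1 j (by simpa using hj)) h2
        · rfl
        · obtain ⟨j, hj⟩ := hx.2 γ h3
          rw [h4 j] at hj; cases hj
        · rfl
    · rw [not_and_or] at hx
      symm
      rcases hx with hx | hx
      · refine Finset.prod_eq_zero (Finset.mem_univ β) ?_
        simp only [F, if_true]
        rw [if_neg]
        exact fun h => hx fun j hj => h j (by simpa using hj)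
      · push Not at hx
        obtain ⟨γ, hγ, hj⟩ := hx
        refine Finset.prod_eq_zero (Finset.mem_univ γ) ?_
        have : γ ≠ β := fun h => hγ (h ▸ hβ)
        simp only [F, if_neg this, if_neg hγ]
        rw [if_pos]
        exact fun j => by simpa using hj j
  rw [Finset.sum_congr rfl fun x _ => hF x, sum_prod_blocks]
  have hS : ∀ γ, ∑ v, F γ v = (if γ = β then (1 / 2) ^ w * 2 ^ blockCount e Q β else 1) *
      (if γ ∈ touched e Q then 1 else 1 - (1 / 2) ^ w) := by
    intro γ
    simp only [F]
    split_ifs with h1 h2 h3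
    · rw [sum_cylinder, mul_one, blockCount]
    · exact absurd (h1 ▸ hβ) h2
    · simp
    · have h2 : ∀ v : Fin w → Bool, (if ∀ j, v j = true then (0 : ℝ) else (1 / 2) ^ w) =
          (1 / 2) ^ w - if v = (fun _ => true) then (1 / 2) ^ w else 0 := by
        intro v
        by_cases hv : ∀ j, v j = true
        · have : v = fun _ => true := funext hv
          simp [this]
        · have : v ≠ fun _ => true := fun hh => hv fun j => by rw [hh]
          simp [hv, this]
      rw [Finset.sum_congr rfl fun v _ => h2 v, Finset.sum_sub_distrib]
      simp
  rw [Finset.prod_congr rfl fun γ _ => hS γ, Finset.prod_mul_distrib, Finset.prod_ite_eq',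
    Finset.prod_ite, Finset.prod_const_one, Finset.prod_const, one_mul, if_pos (Finset.mem_univ _)]
  congr 2
  rw [Finset.filter_not, Finset.card_sdiff_of_subset (Finset.filter_subset _ _)]
  simp

theorem one_le_blockCount {b w n : ℕ} {e : Fin b × Fin w ≃ Fin n} {Q : Finset (Fin n)}
    {β : Fin b} (h : β ∈ touched e Q) : 1 ≤ blockCount e Q β := by
  classical
  obtain ⟨j, hj⟩ := mem_touched.1 h
  exact Finset.card_pos.2 ⟨j, by simpa using hj⟩

theorem uniformProb_controls_le {b w n : ℕ} (hn : n = b * w) (hw : 1 ≤ w)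
    (h4 : (1 : ℝ) / 4 ≤ (1 - (1 / 2) ^ w) ^ 2 ^ w)
    (e : Fin b × Fin w ≃ Fin n) {Q : Finset (Fin n)} (hQ : Q.card ≤ 2 ^ w) :
    uniformProb (Controls e Q) ≤ 8 * (1 - (1 / 2) ^ w) ^ b * (1 / 2) ^ w * load e Q := by
  have hu0 : (0 : ℝ) < (1 / 2) ^ w := by positivity
  have hu1 : ((1 : ℝ) / 2) ^ w ≤ 1 / 2 := by
    simpa using pow_le_pow_of_le_one (by norm_num : (0 : ℝ) ≤ 1 / 2) (by norm_num) hw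
  set u : ℝ := (1 / 2) ^ w
  have htb : (touched e Q).card ≤ b := (Finset.card_le_univ _).trans_eq (by simp)
  have hpow : (1 - u) ^ (b - (touched e Q).card) ≤ 4 * (1 - u) ^ b := by
    have h1 : (1 : ℝ) / 4 ≤ (1 - u) ^ (touched e Q).card :=
      h4.trans (pow_le_pow_of_le_one (by linarith) (by linarith)
        ((card_touched_le e Q).trans hQ))
    have h2 : (1 - u) ^ b = (1 - u) ^ (b - (touched e Q).card) * (1 - u) ^ (touched e Q).card := by
      rw [← pow_add, Nat.sub_add_cancel htb]
    have h3 : 0 ≤ (1 - u) ^ (b - (touched e Q).card) := pow_nonneg (by linarith) _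
    rw [h2]
    nlinarith
  have hd : 0 ≤ (1 - u) ^ b := pow_nonneg (by linarith) _
  calc uniformProb (Controls e Q)
      ≤ ∑ β ∈ touched e Q, uniformProb (fun x => (∀ j, e (β, j) ∉ Q → x (e (β, j)) = true) ∧
          ∀ γ, γ ∉ touched e Q → ∃ j, x (e (γ, j)) = false) := uniformProb_exists_le _ _
    _ = ∑ β ∈ touched e Q, u * 2 ^ blockCount e Q β * (1 - u) ^ (b - (touched e Q).card) :=
        Finset.sum_congr rfl fun β hβ => uniformProb_controls_block hn e Q hβ
    _ ≤ ∑ β ∈ touched e Q, 8 * (1 - u) ^ b * u * ((2 : ℝ) ^ blockCount e Q β - 1) := by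
        refine Finset.sum_le_sum fun β hβ => ?_
        have h2 : (2 : ℝ) ≤ 2 ^ blockCount e Q β := by
          simpa using pow_le_pow_right₀ (by norm_num : (1 : ℝ) ≤ 2) (one_le_blockCount hβ)
        calc _ ≤ u * 2 ^ blockCount e Q β * (4 * (1 - u) ^ b) := by gcongr
          _ ≤ u * (2 * (2 ^ blockCount e Q β - 1)) * (4 * (1 - u) ^ b) := by
            gcongr; linarith
          _ = _ := by ring
    _ ≤ ∑ β, 8 * (1 - u) ^ b * u * ((2 : ℝ) ^ blockCount e Q β - 1) := by
        refine Finset.sum_le_sum_of_subset_of_nonneg (Finset.subset_univ _) fun β _ _ => ?_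
        have : (1 : ℝ) ≤ 2 ^ blockCount e Q β := one_le_pow₀ (by norm_num)
        have : (0 : ℝ) ≤ 2 ^ blockCount e Q β - 1 := by linarith
        positivity
    _ = _ := by rw [load, Finset.mul_sum]

theorem sum_blockCount {b w n : ℕ} (e : Fin b × Fin w ≃ Fin n) (Q : Finset (Fin n)) :
    ∑ β, blockCount e Q β = Q.card := by
  classical
  have h : ∀ β, blockCount e Q β = ∑ j, if e (β, j) ∈ Q then 1 else 0 := fun β => by
    rw [blockCount, Finset.card_filter]
  rw [Finset.sum_congr rfl fun β _ => h β, ← Fintype.sum_prod_type'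
    (f := fun β j => if e (β, j) ∈ Q then 1 else 0)]
  rw [Equiv.sum_comp e (fun i => if i ∈ Q then 1 else 0)]
  simp

theorem load_nonneg {b w n : ℕ} (e : Fin b × Fin w ≃ Fin n) (Q : Finset (Fin n)) :
    0 ≤ load e Q :=
  Finset.sum_nonneg fun β _ => by
    have : (1 : ℝ) ≤ 2 ^ blockCount e Q β := one_le_pow₀ (by norm_num)
    linarith

theorem load_le {b w n : ℕ} (e : Fin b × Fin w ≃ Fin n) (Q : Finset (Fin n)) :
    load e Q ≤ Q.card * 2 ^ w := by
  rw [← sum_blockCount e Q, load]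
  push_cast
  rw [Finset.sum_mul]
  refine Finset.sum_le_sum fun β _ => ?_
  have hk : blockCount e Q β ≤ w := by
    rw [blockCount]
    exact (Finset.card_le_univ _).trans_eq (by simp)
  rcases Nat.eq_zero_or_pos (blockCount e Q β) with h | h
  · simp [h]
  · have h1 : (1 : ℝ) ≤ blockCount e Q β := by exact_mod_cast h
    have h2 : (2 : ℝ) ^ blockCount e Q β ≤ 2 ^ w := pow_le_pow_right₀ (by norm_num) hk
    have : (0 : ℝ) < 2 ^ w := by positivity
    nlinarith

open Classical in
theorem card_equiv_mapsTo_le {ι : Type*} [Fintype ι] [DecidableEq ι] {n : ℕ} (hι : Fintype.card ι = n)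
    (hn : 0 < n) (Q : Finset (Fin n)) (S : Finset ι) :
    ((Finset.univ.filter fun e : ι ≃ Fin n => ∀ i ∈ S, e i ∈ Q).card : ℝ) ≤
      Fintype.card (ι ≃ Fin n) * ((Q.card : ℝ) / n) ^ S.card := by
  have hQn : Q.card ≤ n := (Finset.card_le_univ _).trans_eq (by simp)
  induction S using Finset.induction_on with
  | empty => simp
  | insert a S ha ih =>
    let N : Finset ι → ℕ := fun T => (Finset.univ.filter fun e : ι ≃ Fin n => ∀ i ∈ T, e i ∈ Q).card
    change (N S : ℝ) ≤ _ at ih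
    change (N (insert a S) : ℝ) ≤ _
    have hsn : S.card < n := by
      rw [← hι]
      exact Finset.card_lt_univ_of_notMem ha
    have hsym : ∀ c, c ∉ S → N (insert c S) = N (insert a S) := by
      intro c hc
      refine Finset.card_bij' (fun e _ => (Equiv.swap a c).trans e)
        (fun e _ => (Equiv.swap a c).trans e) ?_ ?_ ?_ ?_
      · intro e he
        simp only [Finset.mem_filter, Finset.mem_univ, true_and, Finset.forall_mem_insert] at he ⊢
        refine ⟨by simpa using he.1, fun i hi => ?_⟩
        have h1 : i ≠ a := fun h => ha (h ▸ hi)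
        have h2 : i ≠ c := fun h => hc (h ▸ hi)
        simpa [Equiv.swap_apply_of_ne_of_ne h1 h2] using he.2 i hi
      · intro e he
        simp only [Finset.mem_filter, Finset.mem_univ, true_and, Finset.forall_mem_insert] at he ⊢
        refine ⟨by simpa using he.1, fun i hi => ?_⟩
        have h1 : i ≠ a := fun h => ha (h ▸ hi)
        have h2 : i ≠ c := fun h => hc (h ▸ hi)
        simpa [Equiv.swap_apply_of_ne_of_ne h1 h2] using he.2 i hi
      · intro e _; ext i; simp
      · intro e _; ext i; simp
    have hsum : (n - S.card) * N (insert a S) = N S * (Q.card - S.card) := by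
      have h1 : ∑ c ∈ Finset.univ \ S, N (insert c S) = (n - S.card) * N (insert a S) := by
        rw [Finset.sum_congr rfl fun c hc => hsym c (by simpa using hc), Finset.sum_const,
          Finset.card_sdiff_of_subset (Finset.subset_univ _), Finset.card_univ, hι, smul_eq_mul]
      rw [← h1]
      have h2 : ∀ c, N (insert c S) = ∑ e ∈ Finset.univ.filter
          fun e : ι ≃ Fin n => ∀ i ∈ S, e i ∈ Q, if e c ∈ Q then 1 else 0 := by
        intro c
        rw [← Finset.card_filter, Finset.filter_filter]
        refine congrArg Finset.card (Finset.filter_congr fun e _ => ?_)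
        simp [and_comm]
      rw [Finset.sum_congr rfl fun c _ => h2 c, Finset.sum_comm]
      rw [Finset.sum_congr rfl (g := fun _ => Q.card - S.card)]
      · rw [Finset.sum_const, smul_eq_mul]
      · intro e he
        have he' : ∀ i ∈ S, e i ∈ Q := (Finset.mem_filter.1 he).2
        rw [← Finset.card_filter]
        have h3 : (Finset.univ \ S).filter (fun c => e c ∈ Q) =
            (Q \ S.map e.toEmbedding).map e.symm.toEmbedding := by
          ext c
          simp [Finset.mem_map_equiv, and_comm]
        rw [h3, Finset.card_map, Finset.card_sdiff_of_subset, Finset.card_map]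
        intro i hi
        obtain ⟨c, hc, rfl⟩ := Finset.mem_map.1 hi
        exact he' c hc
    have hn' : (0 : ℝ) < n := by exact_mod_cast hn
    have hstep : (N (insert a S) : ℝ) ≤ N S * ((Q.card : ℝ) / n) := by
      rcases le_or_gt S.card Q.card with hle | hlt
      · have hR : ((n : ℝ) - S.card) * N (insert a S) = N S * (Q.card - S.card) := by
          rw [← Nat.cast_sub hsn.le, ← Nat.cast_sub hle]
          exact_mod_cast hsum
        have h5 : (0 : ℝ) < n - S.card := by
          have : (S.card : ℝ) < n := by exact_mod_cast hsn
          linarith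
        have h6 : (Q.card : ℝ) ≤ n := by exact_mod_cast hQn
        rw [← mul_div_assoc, le_div_iff₀ hn']
        refine le_of_mul_le_mul_left ?_ h5
        have : (0 : ℝ) ≤ N S * S.card * (n - Q.card) := by
          have : (0 : ℝ) ≤ n - Q.card := by linarith
          positivity
        calc ((n : ℝ) - S.card) * (N (insert a S) * n) = N S * (Q.card - S.card) * n := by
              rw [← hR]; ring
          _ ≤ _ := by linarith
      · rw [Nat.sub_eq_zero_of_le hlt.le, mul_zero] at hsum
        rcases Nat.mul_eq_zero.1 hsum with h | h
        · omega
        · rw [h]; simp only [Nat.cast_zero]; positivity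
    rw [Finset.card_insert_of_notMem ha, pow_succ, ← mul_assoc]
    exact hstep.trans (mul_le_mul_of_nonneg_right ih (by positivity))

theorem sum_two_pow_blockCount_le {b w n : ℕ} (hn : n = b * w) (h0 : 0 < n)
    (Q : Finset (Fin n)) (β : Fin b) :
    ∑ e : Fin b × Fin w ≃ Fin n, (2 : ℝ) ^ blockCount e Q β ≤
      Fintype.card (Fin b × Fin w ≃ Fin n) * (1 + (Q.card : ℝ) / n) ^ w := by
  classical
  have h : ∀ e : Fin b × Fin w ≃ Fin n, (2 : ℝ) ^ blockCount e Q β =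
      ∑ S : Finset (Fin w), if ∀ i ∈ S.map ⟨fun j => (β, j), Prod.mk_right_injective β⟩, e i ∈ Q
        then 1 else 0 := by
    intro e
    have h1 : (2 : ℝ) ^ blockCount e Q β = ∏ j, (1 + if e (β, j) ∈ Q then (1 : ℝ) else 0) := by
      rw [blockCount, ← Finset.prod_const, Finset.prod_filter]
      refine Finset.prod_congr rfl fun j _ => ?_
      split_ifs <;> norm_num
    rw [h1, Finset.prod_one_add, Finset.powerset_univ]
    refine Finset.sum_congr rfl fun S _ => ?_
    rw [Finset.prod_ite_zero]
    simp
  rw [Finset.sum_congr rfl fun e _ => h e, Finset.sum_comm]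
  have hc : Fintype.card (Fin b × Fin w) = n := by simp [hn]
  calc _ ≤ ∑ S : Finset (Fin w), (Fintype.card (Fin b × Fin w ≃ Fin n) : ℝ) *
        ((Q.card : ℝ) / n) ^ S.card := by
        refine Finset.sum_le_sum fun S _ => ?_
        have := card_equiv_mapsTo_le hc h0 Q
          (S.map ⟨fun j => (β, j), Prod.mk_right_injective β⟩)
        rw [Finset.card_map] at this
        rw [← Finset.sum_filter, Finset.sum_const, nsmul_eq_mul, mul_one]
        exact this
    _ = _ := by
        rw [← Finset.mul_sum]
        congr 1
        have := Finset.prod_one_add (f := fun _ => (Q.card : ℝ) / n) (Finset.univ : Finset (Fin w))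
        rw [Finset.prod_const, Finset.card_univ, Fintype.card_fin, Finset.powerset_univ] at this
        rw [this]
        exact Finset.sum_congr rfl fun S _ => by rw [Finset.prod_const]

theorem sum_load_le {b w n : ℕ} (hn : n = b * w) (h0 : 0 < n) (Q : Finset (Fin n))
    (hQ : Q.card ≤ b) :
    ∑ e : Fin b × Fin w ≃ Fin n, load e Q ≤
      Fintype.card (Fin b × Fin w ≃ Fin n) * (2 * Q.card) := by
  have hn' : (0 : ℝ) < n := by exact_mod_cast h0
  have hb : (0 : ℝ) < b := by
    rcases Nat.eq_zero_or_pos b with h | h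
    · simp [h] at hn; omega
    · exact_mod_cast h
  have hw : (n : ℝ) = b * w := by exact_mod_cast hn
  have hQb : (Q.card : ℝ) / b ≤ 1 := div_le_one_of_le₀ (by exact_mod_cast hQ) hb.le
  have hexp : (1 + (Q.card : ℝ) / n) ^ w ≤ 1 + 2 * (Q.card / b) := by
    have h1 : (1 + (Q.card : ℝ) / n) ^ w ≤ Real.exp (Q.card / b) := by
      calc (1 + (Q.card : ℝ) / n) ^ w ≤ Real.exp (Q.card / n) ^ w := by
            gcongr; linarith [Real.add_one_le_exp ((Q.card : ℝ) / n)]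
        _ = Real.exp (Q.card / b) := by
            rw [← Real.exp_nat_mul]
            congr 1
            have hw0 : (w : ℝ) ≠ 0 := by rintro h; rw [h] at hw; simp at hw; linarith
            rw [hw]; field_simp
    have h0' : (0 : ℝ) ≤ (Q.card : ℝ) / b := by positivity
    have h2 := Real.abs_exp_sub_one_le (x := (Q.card : ℝ) / b) (by rwa [abs_of_nonneg h0'])
    rw [abs_of_nonneg h0'] at h2
    linarith [le_abs_self (Real.exp ((Q.card : ℝ) / b) - 1)]
  simp only [load]
  rw [Finset.sum_comm]
  set K : ℝ := ((Fintype.card (Fin b × Fin w ≃ Fin n) : ℕ) : ℝ)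
  calc _ ≤ ∑ _β : Fin b, K * (2 * (Q.card / b)) := by
        refine Finset.sum_le_sum fun β _ => ?_
        rw [Finset.sum_sub_distrib, Finset.sum_const, nsmul_eq_mul, mul_one, Finset.card_univ]
        have h1 := sum_two_pow_blockCount_le hn h0 Q β
        have h2 : K * (1 + (Q.card : ℝ) / n) ^ w ≤ K * (1 + 2 * (Q.card / b)) :=
          mul_le_mul_of_nonneg_left hexp (by positivity)
        linarith
    _ = _ := by
        rw [Finset.sum_const, nsmul_eq_mul, Finset.card_univ, Fintype.card_fin]
        field_simp

theorem sum_exp_load_le {b w n : ℕ} (hn : n = b * w) (h0 : 0 < n) (Q : Finset (Fin n))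
    (hQ : Q.card ≤ b) (hQ0 : 0 < Q.card) :
    ∑ e : Fin b × Fin w ≃ Fin n, Real.exp (load e Q / (Q.card * 2 ^ w)) ≤
      Fintype.card (Fin b × Fin w ≃ Fin n) * Real.exp (4 * (1 / 2) ^ w) := by
  have hq : (0 : ℝ) < Q.card := by exact_mod_cast hQ0
  have h1 : ∀ e : Fin b × Fin w ≃ Fin n, Real.exp (load e Q / (Q.card * 2 ^ w)) ≤
      1 + load e Q * (2 / (Q.card * 2 ^ w)) := by
    intro e
    have hy0 : 0 ≤ load e Q / (Q.card * 2 ^ w) := div_nonneg (load_nonneg e Q) (by positivity)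
    have hy1 : load e Q / (Q.card * 2 ^ w) ≤ 1 := div_le_one_of_le₀ (load_le e Q) (by positivity)
    have h2 := Real.abs_exp_sub_one_le (by rwa [abs_of_nonneg hy0])
    rw [abs_of_nonneg hy0] at h2
    have h3 := le_abs_self (Real.exp (load e Q / (Q.card * 2 ^ w)) - 1)
    have h4 : load e Q * (2 / (Q.card * 2 ^ w)) = 2 * (load e Q / (Q.card * 2 ^ w)) := by ring
    linarith
  refine (Finset.sum_le_sum fun e _ => h1 e).trans ?_
  rw [Finset.sum_add_distrib, ← Finset.sum_mul, Finset.sum_const, nsmul_eq_mul, mul_one,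
    Finset.card_univ]
  set K : ℝ := ((Fintype.card (Fin b × Fin w ≃ Fin n) : ℕ) : ℝ)
  have hK : 0 ≤ K := by positivity
  calc K + (∑ e : Fin b × Fin w ≃ Fin n, load e Q) * (2 / (Q.card * 2 ^ w))
      ≤ K + K * (2 * Q.card) * (2 / (Q.card * 2 ^ w)) := by
        gcongr
        exact sum_load_le hn h0 Q hQ
    _ = K * (4 * (1 / 2) ^ w + 1) := by
        rw [one_div, inv_pow]; field_simp; ring
    _ ≤ _ := by
        gcongr
        exact Real.add_one_le_exp _

namespace MonotoneCircuit

variable {n : ℕ}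

theorem nodeDepth_inl (C : MonotoneCircuit n) (i : Fin n) : C.nodeDepth (Sum.inl i) = 0 := by
  rw [nodeDepth]

theorem nodeDepth_inr (C : MonotoneCircuit n) (g : C.Gate) {d : ℕ} (hne : (C.inputs g).Nonempty)
    (h : ∀ p ∈ C.inputs g, C.nodeDepth p = d) : C.nodeDepth (Sum.inr g) = d + 1 := by
  rw [nodeDepth]
  congr 1
  rw [Finset.sup_congr rfl (g := fun _ => d) fun p _ => h p.1 p.2]
  exact Finset.sup_const (by simpa using hne) _

end MonotoneCircuit

/-- The gates of a conjunction of `m` tribes functions: the output gate, the tribes, and the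
blocks. -/
abbrev TribesGate (m b : ℕ) := Unit ⊕ (Fin m ⊕ Fin m × Fin b)

/-- The conjunction of `m` tribes functions as a circuit of depth three. -/
def tribesCircuit {b w n m : ℕ} (e : Fin m → (Fin b × Fin w ≃ Fin n)) : MonotoneCircuit n where
  Gate := TribesGate m b
  fintypeGate := inferInstance
  kind
    | Sum.inl _ => GateKind.and
    | Sum.inr (Sum.inl _) => GateKind.or
    | Sum.inr (Sum.inr _) => GateKind.and
  inputs
    | Sum.inl _ => Finset.univ.map
        ⟨fun i : Fin m => Sum.inr (Sum.inr (Sum.inl i)), fun i j h => by simpa using h⟩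
    | Sum.inr (Sum.inl i) => Finset.univ.map
        ⟨fun β : Fin b => Sum.inr (Sum.inr (Sum.inr (i, β))), fun β γ h => by simpa using h⟩
    | Sum.inr (Sum.inr (i, β)) => Finset.univ.map
        ⟨fun j : Fin w => Sum.inl (e i (β, j)), fun j k h => by simpa using h⟩
  acyclic := by
    let rank : Fin n ⊕ TribesGate m b → ℕ := fun p => match p with
      | Sum.inl _ => 0
      | Sum.inr (Sum.inr (Sum.inr _)) => 1
      | Sum.inr (Sum.inr (Sum.inl _)) => 2
      | Sum.inr (Sum.inl _) => 3
    refine Subrelation.wf ?_ (measure rank).wf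
    rintro p q ⟨g, rfl, hp⟩
    rcases g with _ | i | ⟨i, β⟩ <;> obtain ⟨k, -, rfl⟩ := Finset.mem_map.1 hp
    exacts [show 2 < 3 by norm_num, show 1 < 2 by norm_num, show 0 < 1 by norm_num]
  output := Sum.inr (Sum.inl ())

theorem tribesCircuit_eval {b w n m : ℕ} (e : Fin m → (Fin b × Fin w ≃ Fin n))
    (x : Fin n → Bool) : (tribesCircuit e).eval x = true ↔ ∀ i, Tribe (e i) x := by
  have h1 : ∀ i β, (tribesCircuit e).value x (Sum.inr (Sum.inr (Sum.inr (i, β)))) = true ↔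
      ∀ j, x (e i (β, j)) = true := by
    intro i β
    refine (MonotoneCircuit.value_and (tribesCircuit e) x
      (Sum.inr (Sum.inr (i, β)) : TribesGate m b) rfl).trans ⟨fun H j => ?_, fun H p hp => ?_⟩
    · exact (MonotoneCircuit.value_inl _ _ _).symm.trans
        (H _ (Finset.mem_map_of_mem _ (Finset.mem_univ j)))
    · obtain ⟨j, -, rfl⟩ := Finset.mem_map.1 hp
      exact (MonotoneCircuit.value_inl _ _ _).trans (H j)
  have h2 : ∀ i, (tribesCircuit e).value x (Sum.inr (Sum.inr (Sum.inl i))) = true ↔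
      Tribe (e i) x := by
    intro i
    refine (MonotoneCircuit.value_or (tribesCircuit e) x
      (Sum.inr (Sum.inl i) : TribesGate m b) rfl).trans ⟨?_, ?_⟩
    · rintro ⟨p, hp, hv⟩
      obtain ⟨β, -, rfl⟩ := Finset.mem_map.1 hp
      exact ⟨β, (h1 i β).1 hv⟩
    · rintro ⟨β, hβ⟩
      exact ⟨_, Finset.mem_map_of_mem _ (Finset.mem_univ β), (h1 i β).2 hβ⟩
  refine (MonotoneCircuit.value_and (tribesCircuit e) x
    (Sum.inl () : TribesGate m b) rfl).trans ⟨fun H i => ?_, fun H p hp => ?_⟩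
  · exact (h2 i).1 (H _ (Finset.mem_map_of_mem _ (Finset.mem_univ i)))
  · obtain ⟨i, -, rfl⟩ := Finset.mem_map.1 hp
    exact (h2 i).2 (H i)

theorem tribesCircuit_depth {b w n m : ℕ} (hm : 0 < m) (hb : 0 < b) (hw : 0 < w)
    (e : Fin m → (Fin b × Fin w ≃ Fin n)) : (tribesCircuit e).depth = 3 := by
  have h1 : ∀ i β, (tribesCircuit e).nodeDepth (Sum.inr (Sum.inr (Sum.inr (i, β)))) = 1 := by
    intro i β
    refine MonotoneCircuit.nodeDepth_inr _ _ ?_ ?_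
    · exact ⟨_, Finset.mem_map_of_mem _ (Finset.mem_univ (⟨0, hw⟩ : Fin w))⟩
    · intro p hp
      obtain ⟨k, -, rfl⟩ := Finset.mem_map.1 hp
      exact MonotoneCircuit.nodeDepth_inl _ _
  have h2 : ∀ i, (tribesCircuit e).nodeDepth (Sum.inr (Sum.inr (Sum.inl i))) = 2 := by
    intro i
    refine MonotoneCircuit.nodeDepth_inr _ _ ?_ ?_
    · exact ⟨_, Finset.mem_map_of_mem _ (Finset.mem_univ (⟨0, hb⟩ : Fin b))⟩
    · intro p hp
      obtain ⟨k, -, rfl⟩ := Finset.mem_map.1 hp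
      exact h1 i k
  refine MonotoneCircuit.nodeDepth_inr _ _ ?_ ?_
  · exact ⟨_, Finset.mem_map_of_mem _ (Finset.mem_univ (⟨0, hm⟩ : Fin m))⟩
  · intro p hp
    obtain ⟨k, -, rfl⟩ := Finset.mem_map.1 hp
    exact h2 k

theorem tribesCircuit_size {b w n m : ℕ} (e : Fin m → (Fin b × Fin w ≃ Fin n)) :
    (tribesCircuit e).size = 1 + (m + m * b) + (m + (m * b + m * b * w)) := by
  change Fintype.card (TribesGate m b) +
    ∑ g : TribesGate m b, ((tribesCircuit e).inputs g).card = _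
  congr 1
  · simp [TribesGate]
  · rw [Fintype.sum_sum_type, Fintype.sum_sum_type]
    simp [tribesCircuit, Finset.card_map]

theorem tribesCircuit_influence_le {b w n m : ℕ} (e : Fin m → (Fin b × Fin w ≃ Fin n))
    (Q : Finset (Fin n)) :
    influence (tribesCircuit e).eval Q ≤ ∑ i, uniformProb (Controls (e i) Q) := by
  refine le_trans (uniformProb_mono (R := fun x => ∃ i ∈ Finset.univ, Controls (e i) Q x) ?_)
    (uniformProb_exists_le _ _)
  rintro x ⟨y, z, hy, hz, hne⟩
  have key : ∀ {y z : Fin n → Bool}, (∀ i, i ∉ Q → y i = x i) → (∀ i, i ∉ Q → z i = x i) →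
      (tribesCircuit e).eval y = true → (tribesCircuit e).eval z = false →
      ∃ i ∈ Finset.univ, Controls (e i) Q x := by
    intro y z hy hz h1 h2
    obtain ⟨i, hi⟩ := controls_of_ne e hy hz ((tribesCircuit_eval e y).1 h1)
      (fun h => by rw [(tribesCircuit_eval e z).2 h] at h2; cases h2)
    exact ⟨i, Finset.mem_univ i, hi⟩
  cases h1 : (tribesCircuit e).eval y <;> cases h2 : (tribesCircuit e).eval z
  · rw [h1, h2] at hne; exact absurd rfl hne
  · exact key hz hy h2 h1
  · exact key hy hz h1 h2
  · rw [h1, h2] at hne; exact absurd rfl hne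

theorem influence_empty {n : ℕ} (f : (Fin n → Bool) → Bool) : influence f ∅ = 0 := by
  have h : ∀ x, ¬ NotFixed f ∅ x := by
    rintro x ⟨y, z, hy, hz, hne⟩
    refine hne (congrArg f (funext fun i => ?_))
    rw [hy i (by simp), hz i (by simp)]
  simp [influence, uniformProb, h]

theorem tradeoffResilient_tribesCircuit {b w n m : ℕ} (hn : n = b * w) (hw : 1 ≤ w)
    (h4 : (1 : ℝ) / 4 ≤ (1 - (1 / 2) ^ w) ^ 2 ^ w) {e : Fin m → (Fin b × Fin w ≃ Fin n)}
    {A ρ : ℝ} (hA : 1 ≤ A) (hρ : A * (1 / 2) ^ w ≤ ρ)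
    (hload : ∀ Q : Finset (Fin n), 0 < Q.card → Q.card ≤ 2 ^ w →
      8 * (1 - (1 / 2) ^ w) ^ b * ∑ i, load (e i) Q ≤ A * Q.card) :
    TradeoffResilient ρ (tribesCircuit e).eval := by
  intro Q
  have hu : (0 : ℝ) < (1 / 2) ^ w := by positivity
  rcases Nat.eq_zero_or_pos Q.card with h0 | h0
  · rw [Finset.card_eq_zero.1 h0, influence_empty]
    simp
  refine le_trans ?_ (mul_le_mul_of_nonneg_left hρ (Nat.cast_nonneg _))
  rcases le_or_gt Q.card (2 ^ w) with hQ | hQ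
  · calc influence (tribesCircuit e).eval Q ≤ ∑ i, uniformProb (Controls (e i) Q) :=
          tribesCircuit_influence_le e Q
      _ ≤ ∑ i, 8 * (1 - (1 / 2) ^ w) ^ b * (1 / 2) ^ w * load (e i) Q :=
          Finset.sum_le_sum fun i _ => uniformProb_controls_le hn hw h4 (e i) hQ
      _ = (1 / 2) ^ w * (8 * (1 - (1 / 2) ^ w) ^ b * ∑ i, load (e i) Q) := by
          rw [← Finset.mul_sum]; ring
      _ ≤ (1 / 2) ^ w * (A * Q.card) := mul_le_mul_of_nonneg_left (hload Q h0 hQ) hu.le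
      _ = _ := by ring
  · refine (uniformProb_le_one _).trans ?_
    have h1 : (2 : ℝ) ^ w ≤ Q.card := by exact_mod_cast hQ.le
    have h2 : (2 : ℝ) ^ w * (1 / 2) ^ w = 1 := by rw [← mul_pow]; norm_num
    have h3 : 1 ≤ Q.card * ((1 : ℝ) / 2) ^ w :=
      h2.symm.le.trans (mul_le_mul_of_nonneg_right h1 hu.le)
    calc (1 : ℝ) ≤ A * (Q.card * (1 / 2) ^ w) := by nlinarith
      _ = _ := by ring

/-- A conjunction of tribes functions that is true with probability at most one half has an
initial segment that is almost balanced. -/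
theorem exists_balanced_prefix {b w n M : ℕ} (e : Fin M → (Fin b × Fin w ≃ Fin n))
    (hM : uniformProb (fun x => ∀ i, Tribe (e i) x) ≤ 1 / 2) :
    ∃ (m : ℕ) (hm : m ≤ M), 0 < m ∧
      |uniformProb (fun x => ∀ i, Tribe (e (Fin.castLE hm i)) x) - 1 / 2| ≤
        (1 - (1 / 2) ^ w) ^ b := by
  classical
  let g : ℕ → ℝ := fun m => uniformProb (fun x => ∀ i : Fin M, i.1 < m → Tribe (e i) x)
  have hex : ∃ m, g m ≤ 1 / 2 :=
    ⟨M, (uniformProb_mono fun x hx i => hx i i.2).trans hM⟩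
  have hg0 : g 0 = 1 := by simp [g, uniformProb_true]
  have hspec : g (Nat.find hex) ≤ 1 / 2 := Nat.find_spec hex
  have hle : Nat.find hex ≤ M :=
    Nat.find_min' hex ((uniformProb_mono fun x hx i => hx i i.2).trans hM)
  have hmin : ∀ k, k < Nat.find hex → 1 / 2 < g k := fun k hk => not_le.1 (Nat.find_min hex hk)
  generalize Nat.find hex = m at hspec hle hmin
  rcases m with _ | k
  · rw [hg0] at hspec; norm_num at hspec
  refine ⟨k + 1, hle, Nat.succ_pos k, ?_⟩
  have heq : uniformProb (fun x => ∀ i, Tribe (e (Fin.castLE hle i)) x) = g (k + 1) := by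
    refine le_antisymm (uniformProb_mono fun x hx i hi => hx ⟨i, hi⟩)
      (uniformProb_mono fun x hx i => hx _ i.2)
  have hstep : g k ≤ g (k + 1) + (1 - (1 / 2) ^ w) ^ b := by
    rw [← uniformProb_not_tribe (e ⟨k, hle⟩)]
    have := uniformProb_exists_le (Finset.univ : Finset Bool)
      (fun c x => if c = true then ∀ i : Fin M, i.1 < k + 1 → Tribe (e i) x
        else ¬ Tribe (e ⟨k, hle⟩) x)
    rw [Fintype.sum_bool] at this
    simp only [if_true, Bool.false_eq_true, if_false] at this
    refine (uniformProb_mono fun x hx => ?_).trans this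
    by_cases h : Tribe (e ⟨k, hle⟩) x
    · refine ⟨true, Finset.mem_univ _, ?_⟩
      rw [if_pos rfl]
      intro i hi
      rcases Nat.lt_succ_iff_lt_or_eq.1 hi with hi | hi
      · exact hx i hi
      · have : i = ⟨k, hle⟩ := Fin.ext hi
        rwa [this]
    · exact ⟨false, Finset.mem_univ _, by simpa using h⟩
  have h1 := hmin k (Nat.lt_succ_self k)
  rw [heq, abs_le]
  constructor <;> linarith

theorem sum_uniformProb_forall_tribe {b w n M : ℕ} :
    ∑ e : Fin M → (Fin b × Fin w ≃ Fin n), uniformProb (fun x => ∀ i, Tribe (e i) x) =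
      (Fintype.card (Fin b × Fin w ≃ Fin n) : ℝ) ^ M *
        ∑ x : Fin n → Bool, (1 / 2) ^ n * (1 - missFraction b w x) ^ M := by
  classical
  have h1 : ∀ e : Fin M → (Fin b × Fin w ≃ Fin n), uniformProb (fun x => ∀ i, Tribe (e i) x) =
      ∑ x, (1 / 2) ^ n * ∏ i, if Tribe (e i) x then (1 : ℝ) else 0 := by
    intro e
    rw [uniformProb_eq_sum]
    refine Finset.sum_congr rfl fun x _ => ?_
    rw [Finset.prod_ite_zero]
    simp
  rw [Finset.sum_congr rfl fun e _ => h1 e, Finset.sum_comm, Finset.mul_sum]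
  refine Finset.sum_congr rfl fun x _ => ?_
  rw [← Finset.mul_sum, ← Fintype.sum_pow (fun e : Fin b × Fin w ≃ Fin n =>
    if Tribe e x then (1 : ℝ) else 0), mul_left_comm, ← mul_pow]
  congr 2
  rw [← Finset.sum_filter, Finset.sum_const, nsmul_eq_mul, mul_one, missFraction]
  rcases Nat.eq_zero_or_pos (Fintype.card (Fin b × Fin w ≃ Fin n)) with h | h
  · have := Fintype.card_eq_zero_iff.1 h
    simp
  · have h' : (0 : ℝ) < Fintype.card (Fin b × Fin w ≃ Fin n) := by exact_mod_cast h
    rw [mul_sub, mul_div_cancel₀ _ h'.ne', mul_one, eq_sub_iff_add_eq]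
    have := Finset.card_filter_add_card_filter_not
      (s := (Finset.univ : Finset (Fin b × Fin w ≃ Fin n))) (fun e => Tribe e x)
    rw [Finset.card_univ] at this
    rw [← this]
    push_cast
    congr!

theorem sum_one_sub_missFraction_pow_le {b w n M : ℕ} {a κ : ℝ}
    (ha : ∀ x : Fin n → Bool, (onesCount x : ℝ) ≤ κ → a ≤ missFraction b w x) :
    ∑ x : Fin n → Bool, (1 / 2) ^ n * (1 - missFraction b w x) ^ M ≤
      uniformProb (fun x : Fin n → Bool => κ < onesCount x) + Real.exp (-(M * a)) := by
  classical
  have hs : Real.exp (-(M * a)) = ∑ _x : Fin n → Bool, (1 / 2) ^ n * Real.exp (-(M * a)) := by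
    rw [Finset.sum_const, nsmul_eq_mul, ← mul_assoc]
    simp
  rw [hs, uniformProb_eq_sum, ← Finset.sum_add_distrib]
  refine Finset.sum_le_sum fun x _ => ?_
  have h0 := missFraction_nonneg b w x
  have h1 := missFraction_le_one b w x
  split_ifs with hx
  · have : (1 - missFraction b w x) ^ M ≤ 1 := pow_le_one₀ (by linarith) (by linarith)
    have h2 : (0 : ℝ) < (1 / 2) ^ n := by positivity
    have h3 : (0 : ℝ) < (1 / 2) ^ n * Real.exp (-(M * a)) := by positivity
    nlinarith
  · rw [zero_add]
    gcongr
    calc (1 - missFraction b w x) ^ M ≤ Real.exp (-a) ^ M := by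
          refine pow_le_pow_left₀ (by linarith) ?_ M
          linarith [Real.add_one_le_exp (-a), ha x (not_lt.1 hx)]
      _ = _ := by rw [← Real.exp_nat_mul]; congr 1; ring

open Classical in
theorem sum_exp_total_load_le {b w n M : ℕ} (hn : n = b * w) (h0 : 0 < n) (hwb : 2 ^ w ≤ b) :
    ∑ e : Fin M → (Fin b × Fin w ≃ Fin n),
      ∑ Q : Finset (Fin n), (if 0 < Q.card ∧ Q.card ≤ 2 ^ w then
        Real.exp (∑ i, load (e i) Q / (Q.card * 2 ^ w) - 6 * M * (1 / 2) ^ w) else 0) ≤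
      (Fintype.card (Fin b × Fin w ≃ Fin n) : ℝ) ^ M *
        (2 ^ n * Real.exp (-(2 * M * (1 / 2) ^ w))) := by
  rw [Finset.sum_comm]
  set K : ℝ := ((Fintype.card (Fin b × Fin w ≃ Fin n) : ℕ) : ℝ)
  calc _ ≤ ∑ _Q : Finset (Fin n), K ^ M * Real.exp (-(2 * M * (1 / 2) ^ w)) := by
        refine Finset.sum_le_sum fun Q _ => ?_
        split_ifs with hQ
        · have h1 : ∀ e : Fin M → (Fin b × Fin w ≃ Fin n),
              Real.exp (∑ i, load (e i) Q / (Q.card * 2 ^ w) - 6 * M * (1 / 2) ^ w) =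
              Real.exp (-(6 * M * (1 / 2) ^ w)) *
                ∏ i, Real.exp (load (e i) Q / (Q.card * 2 ^ w)) := by
            intro e
            rw [← Real.exp_sum, ← Real.exp_add]
            congr 1
            ring
          rw [Finset.sum_congr rfl fun e _ => h1 e, ← Finset.mul_sum,
            ← Fintype.sum_pow (fun e : Fin b × Fin w ≃ Fin n =>
              Real.exp (load e Q / (Q.card * 2 ^ w)))]
          calc _ ≤ Real.exp (-(6 * M * (1 / 2) ^ w)) * (K * Real.exp (4 * (1 / 2) ^ w)) ^ M := by
                gcongr
                exact sum_exp_load_le hn h0 Q (hQ.2.trans hwb) hQ.1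
            _ = _ := by
                rw [mul_pow, mul_left_comm, ← Real.exp_nat_mul, ← Real.exp_add]
                congr 2
                ring
        · rw [Finset.sum_const_zero]
          positivity
    _ = _ := by
        rw [Finset.sum_const, nsmul_eq_mul, Finset.card_univ, Fintype.card_finset,
          Fintype.card_fin]
        push_cast
        ring

/-- Some choice of `M` layouts is both unlikely to be satisfied and evenly loaded by all small
coalitions. -/
theorem exists_layouts {b w n M : ℕ} {a κ : ℝ} (hn : n = b * w) (h0 : 0 < n) (hwb : 2 ^ w ≤ b)
    (ha : ∀ x : Fin n → Bool, (onesCount x : ℝ) ≤ κ → a ≤ missFraction b w x)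
    (htail : uniformProb (fun x : Fin n → Bool => κ < onesCount x) ≤ 1 / 50)
    (hMa : 4 ≤ M * a) (hMn : (n : ℝ) ≤ M * (1 / 2) ^ w) :
    ∃ e : Fin M → (Fin b × Fin w ≃ Fin n),
      uniformProb (fun x => ∀ i, Tribe (e i) x) ≤ 1 / 2 ∧
      ∀ Q : Finset (Fin n), 0 < Q.card → Q.card ≤ 2 ^ w →
        ∑ i, load (e i) Q ≤ 6 * M * Q.card := by
  classical
  set K : ℝ := ((Fintype.card (Fin b × Fin w ≃ Fin n) : ℕ) : ℝ) with hK
  have e₀ : Fin b × Fin w ≃ Fin n := Fintype.equivOfCardEq (by simp [hn])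
  have hKpos : 0 < K :=
    Nat.cast_pos.2 (Fintype.card_pos_iff.2 ⟨e₀⟩)
  let G : (Fin M → (Fin b × Fin w ≃ Fin n)) → Finset (Fin n) → ℝ := fun e Q =>
    if 0 < Q.card ∧ Q.card ≤ 2 ^ w then
      Real.exp (∑ i, load (e i) Q / (Q.card * 2 ^ w) - 6 * M * (1 / 2) ^ w) else 0
  have hG0 : ∀ e Q, 0 ≤ G e Q := fun e Q => by
    simp only [G]; split_ifs <;> positivity
  have he1 : Real.exp (-1) < 1 / 2 := by
    have := Real.exp_neg_one_lt_half; linarith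
  have hexp4 : Real.exp (-(M * a)) ≤ 1 / 16 := by
    calc Real.exp (-(M * a)) ≤ Real.exp ((4 : ℕ) * (-1)) := by
          gcongr; push_cast; linarith
      _ = Real.exp (-1) ^ 4 := Real.exp_nat_mul _ _
      _ ≤ (1 / 2) ^ 4 := by gcongr
      _ = _ := by norm_num
  have hexp2 : (2 : ℝ) ^ n * Real.exp (-(2 * M * (1 / 2) ^ w)) ≤ 1 / 2 := by
    calc (2 : ℝ) ^ n * Real.exp (-(2 * M * (1 / 2) ^ w))
        ≤ 2 ^ n * Real.exp ((n : ℝ) * (-1 + -1)) := by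
          gcongr; linarith
      _ = (2 * (Real.exp (-1) * Real.exp (-1))) ^ n := by
          rw [Real.exp_nat_mul, ← mul_pow, Real.exp_add]
      _ ≤ (2 * (1 / 2 * (1 / 2))) ^ n := by gcongr
      _ ≤ (2 * (1 / 2 * (1 / 2))) ^ 1 := pow_le_pow_of_le_one (by norm_num) (by norm_num) h0
      _ = _ := by norm_num
  have htot : ∑ e : Fin M → (Fin b × Fin w ≃ Fin n),
      (2 * uniformProb (fun x => ∀ i, Tribe (e i) x) + ∑ Q, G e Q) <
      ∑ _e : Fin M → (Fin b × Fin w ≃ Fin n), (1 : ℝ) := by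
    rw [Finset.sum_add_distrib, ← Finset.mul_sum, sum_uniformProb_forall_tribe]
    have h1 := sum_one_sub_missFraction_pow_le (M := M) ha
    have h2 := sum_exp_total_load_le (M := M) hn h0 hwb
    rw [← hK] at h2 ⊢
    have hKM : 0 < K ^ M := by positivity
    calc _ ≤ 2 * (K ^ M * (1 / 50 + 1 / 16)) + K ^ M * (1 / 2) := by
          refine add_le_add ?_ (h2.trans (by gcongr))
          gcongr
          exact h1.trans (add_le_add htail hexp4)
      _ < K ^ M := by linarith
      _ = _ := by
          rw [Finset.sum_const, nsmul_eq_mul, mul_one, Finset.card_univ, Fintype.card_fun,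
            Fintype.card_fin]
          push_cast
          rfl
  obtain ⟨e, -, he⟩ := Finset.exists_lt_of_sum_lt htot
  have hsum0 : 0 ≤ ∑ Q, G e Q := Finset.sum_nonneg fun Q _ => hG0 e Q
  refine ⟨e, by linarith, fun Q hQ0 hQ => ?_⟩
  have hGQ : G e Q < 1 := by
    have := Finset.single_le_sum (fun Q _ => hG0 e Q) (Finset.mem_univ Q)
    have hp := uniformProb_nonneg (fun x => ∀ i, Tribe (e i) x)
    linarith
  simp only [G] at hGQ
  rw [if_pos ⟨hQ0, hQ⟩, Real.exp_lt_one_iff, ← Finset.sum_div, sub_neg] at hGQ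
  have hq : (0 : ℝ) < Q.card := by exact_mod_cast hQ0
  rw [div_lt_iff₀ (by positivity)] at hGQ
  refine hGQ.le.trans_eq ?_
  rw [one_div, inv_pow]
  field_simp

theorem quarter_le_one_sub_pow {w : ℕ} (hw : 1 ≤ w) :
    (1 : ℝ) / 4 ≤ (1 - (1 / 2) ^ w) ^ 2 ^ w := by
  obtain ⟨k, rfl⟩ : ∃ k, w = k + 1 := ⟨w - 1, by omega⟩
  have hu : ((1 : ℝ) / 2) ^ (k + 1) ≤ 1 := pow_le_one₀ (by norm_num) (by norm_num)
  have h := one_add_mul_le_pow (a := -((1 : ℝ) / 2) ^ (k + 1)) (by linarith) (2 ^ k)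
  have h2 : (1 : ℝ) + ((2 ^ k : ℕ) : ℝ) * -(1 / 2) ^ (k + 1) = 1 / 2 := by
    push_cast
    have : (2 : ℝ) ^ k * (1 / 2) ^ k = 1 := by rw [← mul_pow]; norm_num
    rw [pow_succ]
    linear_combination (-1 / 2) * this
  rw [h2, ← sub_eq_add_neg] at h
  rw [pow_succ 2 k, pow_mul]
  nlinarith

theorem quarter_pow_le_miss {w : ℕ} (hw : 1 ≤ w) :
    ((1 : ℝ) / 4) ^ (3 * w) ≤ (1 - (1 / 2) ^ w) ^ (3 * w * 2 ^ w) := by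
  rw [mul_comm (3 * w) (2 ^ w), pow_mul _ (2 ^ w)]
  exact pow_le_pow_left₀ (by norm_num) (quarter_le_one_sub_pow hw) _

theorem miss_le_inv_pow (w : ℕ) :
    (1 - ((1 : ℝ) / 2) ^ w) ^ (3 * w * 2 ^ w) ≤ (1 / 16) ^ w := by
  have hu : ((1 : ℝ) / 2) ^ w ≤ 1 := pow_le_one₀ (by norm_num) (by norm_num)
  have he : Real.exp (-3) ≤ 1 / 16 := by
    rw [Real.exp_neg, one_div]
    gcongr
    have h1 := Real.exp_one_gt_d9
    calc (16 : ℝ) ≤ 2.7 ^ 3 := by norm_num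
      _ ≤ Real.exp 1 ^ 3 := by gcongr; linarith
      _ = Real.exp 3 := by rw [← Real.exp_nat_mul]; norm_num
  calc (1 - ((1 : ℝ) / 2) ^ w) ^ (3 * w * 2 ^ w)
      ≤ Real.exp (-(1 / 2) ^ w) ^ (3 * w * 2 ^ w) := by
        refine pow_le_pow_left₀ (by linarith) ?_ _
        linarith [Real.add_one_le_exp (-((1 : ℝ) / 2) ^ w)]
    _ = Real.exp (-3) ^ w := by
        rw [← Real.exp_nat_mul, ← Real.exp_nat_mul]
        congr 1
        push_cast
        have : (2 : ℝ) ^ w * (1 / 2) ^ w = 1 := by rw [← mul_pow]; norm_num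
        linear_combination (-3 * (w : ℝ)) * this
    _ ≤ _ := by gcongr

theorem half_miss_le_biased_miss {w : ℕ} (hw : 1 ≤ w) :
    (1 - ((1 : ℝ) / 2) ^ w) ^ (3 * w * 2 ^ w) / 2 ≤
      (1 - (1 / 2 + 1 / (48 * (w : ℝ) ^ 2)) ^ w) ^ (3 * w * 2 ^ w) := by
  have hw1 : (1 : ℝ) ≤ w := by exact_mod_cast hw
  have hu0 : (0 : ℝ) < (1 / 2) ^ w := by positivity
  have hu1 : ((1 : ℝ) / 2) ^ w ≤ 1 / 2 := by
    simpa using pow_le_pow_of_le_one (by norm_num : (0 : ℝ) ≤ 1 / 2) (by norm_num) hw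
  have huw : (2 : ℝ) ^ w * (1 / 2) ^ w = 1 := by rw [← mul_pow]; norm_num
  set s : ℝ := 1 / (48 * (w : ℝ) ^ 2) with hs
  have hs0 : 0 < s := by positivity
  have hsw : s * w ^ 2 = 1 / 48 := by rw [hs]; field_simp
  have hsw1 : s * w ≤ 1 / 48 := by rw [← hsw, sq]; nlinarith [mul_pos hs0 (by linarith : (0 : ℝ) < w)]
  have hsw0 : 0 < s * w := by positivity
  have hp : (1 / 2 + s) ^ w ≤ (1 / 2) ^ w * (1 + 4 * (s * w)) := by
    have h1 : (1 / 2 + s) ^ w = (1 / 2) ^ w * (1 + 2 * s) ^ w := by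
      rw [← mul_pow]; congr 1; ring
    have h2 : (1 + 2 * s) ^ w ≤ Real.exp (2 * (s * w)) := by
      calc (1 + 2 * s) ^ w ≤ Real.exp (2 * s) ^ w := by
            refine pow_le_pow_left₀ (by linarith) ?_ _
            linarith [Real.add_one_le_exp (2 * s)]
        _ = _ := by rw [← Real.exp_nat_mul]; congr 1; ring
    have h3 := Real.abs_exp_sub_one_le (x := 2 * (s * w))
      (by rw [abs_of_nonneg (by linarith)]; linarith)
    rw [abs_of_nonneg (by linarith : 0 ≤ 2 * (s * w))] at h3
    have h4 := le_abs_self (Real.exp (2 * (s * w)) - 1)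
    rw [h1]
    gcongr
    linarith
  set u : ℝ := (1 / 2) ^ w
  have husw : 0 < u * (s * w) := by positivity
  have husw1 : u * (s * w) ≤ 1 / 96 := by nlinarith
  have hbase : (1 - u) * (1 - 8 * (u * (s * w))) ≤ 1 - (1 / 2 + s) ^ w := by nlinarith
  have hber := one_add_mul_le_pow (a := -(8 * (u * (s * w)))) (by linarith) (3 * w * 2 ^ w)
  have heq : (1 : ℝ) + ((3 * w * 2 ^ w : ℕ) : ℝ) * -(8 * (u * (s * w))) = 1 / 2 := by
    push_cast
    linear_combination (-24 * s * w ^ 2) * huw - 24 * hsw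
  rw [heq, ← sub_eq_add_neg] at hber
  calc (1 - u) ^ (3 * w * 2 ^ w) / 2 = (1 - u) ^ (3 * w * 2 ^ w) * (1 / 2) := by ring
    _ ≤ (1 - u) ^ (3 * w * 2 ^ w) * (1 - 8 * (u * (s * w))) ^ (3 * w * 2 ^ w) :=
        mul_le_mul_of_nonneg_left hber (pow_nonneg (by linarith) _)
    _ = ((1 - u) * (1 - 8 * (u * (s * w)))) ^ (3 * w * 2 ^ w) := (mul_pow _ _ _).symm
    _ ≤ _ := pow_le_pow_left₀ (mul_nonneg (by linarith) (by linarith)) hbase _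

theorem exists_balanced_resilient_circuit {w : ℕ} (hw : 2 ≤ w)
    (hbig : 98304 * (w : ℝ) ^ 3 ≤ 2 ^ w) :
    ∃ C : MonotoneCircuit (3 * w * 2 ^ w * w),
      C.depth = 3 ∧ (C.size : ℝ) ≤ ((3 * w * 2 ^ w * w : ℕ) : ℝ) ^ 9 ∧
      (∀ ρ : ℝ, 816 * (1 / 2) ^ w ≤ ρ → TradeoffResilient ρ C.eval) ∧
      bias C.eval ≤ (1 / 16) ^ w := by
  have hw1 : 1 ≤ w := by omega
  have hwR : (1 : ℝ) ≤ w := by exact_mod_cast hw1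
  have hu0 : (0 : ℝ) < (1 / 2) ^ w := by positivity
  have huw : (2 : ℝ) ^ w * (1 / 2) ^ w = 1 := by rw [← mul_pow]; norm_num
  have hδ0 := quarter_pow_le_miss hw1
  have hδ1 := miss_le_inv_pow w
  have hD := half_miss_le_biased_miss hw1
  obtain ⟨b, hb⟩ : ∃ b, b = 3 * w * 2 ^ w := ⟨_, rfl⟩
  obtain ⟨n, hn⟩ : ∃ n, n = b * w := ⟨_, rfl⟩
  rw [← hb] at hδ0 hδ1 hD ⊢
  rw [← hn]
  have h2w : 1 ≤ 2 ^ w := Nat.one_le_two_pow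
  have hbpos : 0 < b := by rw [hb]; positivity
  have hnpos : 0 < n := by rw [hn]; positivity
  have hwb : 2 ^ w ≤ b := by rw [hb]; nlinarith
  have hbn : b ≤ n := by rw [hn]; nlinarith
  have hnR : (n : ℝ) = 3 * w ^ 2 * 2 ^ w := by rw [hn, hb]; push_cast; ring
  set δ : ℝ := (1 - (1 / 2) ^ w) ^ b with hδ
  have hδpos : 0 < δ := lt_of_lt_of_le (by positivity) hδ0
  have hδle : δ ≤ 1 := hδ1.trans (pow_le_one₀ (by norm_num) (by norm_num))
  obtain ⟨M, hMdef⟩ : ∃ M, M = ⌈16 / δ⌉₊ := ⟨_, rfl⟩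
  have hM1 : 16 ≤ M * δ := by
    rw [← div_le_iff₀ hδpos, hMdef]; exact Nat.le_ceil _
  have hM2 : M * δ ≤ 17 := by
    have h := (Nat.ceil_lt_add_one (by positivity : 0 ≤ 16 / δ)).le
    rw [← hMdef] at h
    calc M * δ ≤ (16 / δ + 1) * δ := by gcongr
      _ = 16 + δ := by field_simp
      _ ≤ 17 := by linarith
  set s : ℝ := 1 / (48 * (w : ℝ) ^ 2) with hs
  have hs0 : 0 < s := by positivity
  have hs1 : s < 1 / 2 := by
    rw [hs, div_lt_div_iff₀ (by positivity) (by norm_num)]; nlinarith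
  have hsn : 128 * w ≤ s ^ 2 * n := by
    have : s ^ 2 * n * (768 * w ^ 2) = 2 ^ w := by
      rw [hs, hnR]; field_simp; norm_num
    have h3 : 128 * (w : ℝ) * (768 * w ^ 2) ≤ s ^ 2 * n * (768 * w ^ 2) := by
      rw [this]; calc _ = 98304 * (w : ℝ) ^ 3 := by ring
        _ ≤ _ := hbig
    exact le_of_mul_le_mul_right h3 (by positivity)
  have he1 : Real.exp (-1) < 1 / 2 := Real.exp_neg_one_lt_half
  have hexp : ∀ (k : ℕ) (y : ℝ), (k : ℝ) ≤ y → Real.exp (-y) ≤ (1 / 2) ^ k := by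
    intro k y hy
    calc Real.exp (-y) ≤ Real.exp ((k : ℝ) * (-1)) := by gcongr; linarith
      _ = Real.exp (-1) ^ k := Real.exp_nat_mul _ _
      _ ≤ _ := by gcongr
  have htail : uniformProb (fun x : Fin n → Bool => (n : ℝ) / 2 + s * n / 8 < onesCount x) ≤
      1 / 50 := by
    refine (uniformProb_onesCount_gt_le hs0.le).trans ((hexp 8 _ ?_).trans (by norm_num))
    have : (2 : ℝ) ≤ w := by exact_mod_cast hw
    push_cast; linarith
  have hlow : Real.exp (-(s ^ 2 * n / 4)) ≤ δ / 4 := by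
    refine (hexp (2 * (3 * w + 1)) _ ?_).trans ?_
    · push_cast; linarith
    · rw [pow_mul, pow_succ]
      norm_num at hδ0 ⊢
      linarith
  let e₀ : Fin b × Fin w ≃ Fin n := Fintype.equivOfCardEq (by simp [hn])
  have ha : ∀ x : Fin n → Bool, (onesCount x : ℝ) ≤ n / 2 + s * n / 8 →
      δ / 4 ≤ missFraction b w x := by
    intro x hx
    have h1 := le_missFraction_add (p := 1 / 2 + s) (by linarith) (by linarith) e₀ hx
    have h2 := sum_biasedWeight_lower_tail_le (n := n) hs0.le hs1
    linarith
  have hww : (w : ℝ) ^ 2 ≤ 4 ^ w := by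
    have : (w : ℝ) ≤ 2 ^ w := by exact_mod_cast (Nat.lt_two_pow_self (n := w)).le
    calc (w : ℝ) ^ 2 ≤ (2 ^ w) ^ 2 := by gcongr
      _ = 4 ^ w := by rw [← pow_mul, mul_comm, pow_mul]; norm_num
  have hMn : (n : ℝ) ≤ M * (1 / 2) ^ w := by
    have hM16 : (16 : ℝ) * 16 ^ w ≤ M := by
      have : (1 / 16 : ℝ) ^ w * 16 ^ w = 1 := by rw [← mul_pow]; norm_num
      have h0 : (0 : ℝ) ≤ M := Nat.cast_nonneg M
      have h1 : (16 : ℝ) ≤ M * (1 / 16) ^ w := hM1.trans (by gcongr)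
      calc (16 : ℝ) * 16 ^ w ≤ M * (1 / 16) ^ w * 16 ^ w := by gcongr
        _ = M := by rw [mul_assoc, this, mul_one]
    have h4 : (16 : ℝ) ^ w * (1 / 2) ^ w = 4 ^ w * 2 ^ w := by
      rw [← mul_pow, ← mul_pow]; norm_num
    have h5 : (0 : ℝ) < 2 ^ w := by positivity
    calc (n : ℝ) = 3 * (w ^ 2 * 2 ^ w) := by rw [hnR]; ring
      _ ≤ 16 * (4 ^ w * 2 ^ w) := by gcongr; norm_num
      _ = 16 * 16 ^ w * (1 / 2) ^ w := by rw [← h4]; ring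
      _ ≤ _ := by gcongr
  obtain ⟨e, he, hload⟩ := exists_layouts (M := M) hn hnpos hwb ha htail (by linarith) hMn
  obtain ⟨m, hm, hm0, hbal⟩ := exists_balanced_prefix e he
  refine ⟨tribesCircuit fun i => e (Fin.castLE hm i), tribesCircuit_depth hm0 hbpos hw1 _, ?_,
    fun ρ hρ => ?_, ?_⟩
  · rw [tribesCircuit_size]
    have hn2 : (2 : ℝ) ^ w ≤ n := by exact_mod_cast hwb.trans hbn
    have hn17 : (17 : ℝ) ≤ n := by nlinarith [one_le_pow₀ hwR (n := 3)]
    have hMn7 : (M : ℝ) ≤ n ^ 7 := by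
      have h64 : (1 / 4 : ℝ) ^ (3 * w) * (2 ^ w) ^ 6 = 1 := by
        rw [← pow_mul, mul_comm w 6, pow_mul, pow_mul, ← mul_pow]; norm_num
      calc (M : ℝ) = M * (1 / 4) ^ (3 * w) * (2 ^ w) ^ 6 := by rw [mul_assoc, h64, mul_one]
        _ ≤ M * δ * (2 ^ w) ^ 6 := by gcongr
        _ ≤ 17 * (2 ^ w) ^ 6 := by gcongr
        _ ≤ n * n ^ 6 := by gcongr
        _ = n ^ 7 := by ring
    have hsize : 1 + (m + m * b) + (m + (m * b + m * b * w)) ≤ 6 * (M * n) := by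
      have h1 : m * b * w = m * n := by rw [hn]; ring
      have h2 : m * b ≤ m * n := by gcongr
      have h3 : m * n ≤ M * n := by gcongr
      have h4 : m ≤ m * n := Nat.le_mul_of_pos_right _ hnpos
      omega
    calc ((1 + (m + m * b) + (m + (m * b + m * b * w)) : ℕ) : ℝ) ≤ ((6 * (M * n) : ℕ) : ℝ) := by
          exact_mod_cast hsize
      _ = 6 * (M * n) := by push_cast; ring
      _ ≤ n * (n ^ 7 * n) := by gcongr; linarith
      _ = n ^ 9 := by ring
  · refine tradeoffResilient_tribesCircuit hn hw1 (quarter_le_one_sub_pow hw1)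
      (by norm_num : (1 : ℝ) ≤ 816) hρ fun Q hQ0 hQ => ?_
    have h1 : ∑ i, load (e (Fin.castLE hm i)) Q ≤ ∑ i, load (e i) Q := by
      rw [← Finset.sum_image (s := Finset.univ) (g := Fin.castLE hm)
        (f := fun i => load (e i) Q) fun i _ j _ h => Fin.castLE_injective hm h]
      exact Finset.sum_le_sum_of_subset_of_nonneg (Finset.subset_univ _)
        fun i _ _ => load_nonneg _ _
    calc 8 * δ * ∑ i, load (e (Fin.castLE hm i)) Q ≤ 8 * δ * (6 * M * Q.card) := by
          gcongr; exact h1.trans (hload Q hQ0 hQ)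
      _ = 48 * (M * δ) * Q.card := by ring
      _ ≤ 48 * 17 * Q.card := by gcongr
      _ = _ := by norm_num
  · rw [bias]
    simp only [tribesCircuit_eval]
    exact hbal.trans hδ1

theorem eventually_cube_le_two_pow :
    ∀ᶠ w : ℕ in Filter.atTop, 98304 * (w : ℝ) ^ 3 ≤ 2 ^ w := by
  have h := tendsto_pow_const_div_const_pow_of_one_lt 3 (by norm_num : (1 : ℝ) < 2)
  filter_upwards [h.eventually (gt_mem_nhds (by norm_num : (0 : ℝ) < 1 / 98304))] with w hw
  rw [div_lt_iff₀ (by positivity)] at hw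
  linarith

theorem mainTheorem2 :
    ∃ (c : ℝ) (ε : ℕ → ℝ), 0 < c ∧ Filter.Tendsto ε Filter.atTop (nhds 0) ∧
      {n : ℕ | ∃ C : MonotoneCircuit n,
        C.depth = 3 ∧
        (C.size : ℝ) ≤ (n : ℝ) ^ c ∧
        TradeoffResilient (c * Real.log n ^ 2 / n) C.eval ∧
        bias C.eval ≤ (n : ℝ) ^ (-1 + ε n)}.Infinite := by
  refine ⟨10000, fun _ => 0, by norm_num, tendsto_const_nhds, ?_⟩
  refine Set.infinite_of_forall_exists_gt fun N => ?_
  obtain ⟨w, hbig, hw2, hwN⟩ := (eventually_cube_le_two_pow.and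
    ((Filter.eventually_ge_atTop 2).and (Filter.eventually_gt_atTop N))).exists
  have h2w : 1 ≤ 2 ^ w := Nat.one_le_two_pow
  have hww : w ≤ w * w := Nat.le_mul_self w
  have hn2 : 2 ^ w ≤ 3 * w * 2 ^ w * w := by nlinarith
  refine ⟨3 * w * 2 ^ w * w, ?_, by nlinarith⟩
  obtain ⟨C, hdepth, hsize, hres, hbias⟩ := exists_balanced_resilient_circuit hw2 hbig
  have hnR : ((3 * w * 2 ^ w * w : ℕ) : ℝ) = 3 * w ^ 2 * 2 ^ w := by push_cast; ring
  have hn2R : (2 : ℝ) ^ w ≤ ((3 * w * 2 ^ w * w : ℕ) : ℝ) := by exact_mod_cast hn2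
  have hwR : (2 : ℝ) ≤ w := by exact_mod_cast hw2
  generalize 3 * w * 2 ^ w * w = n at *
  have hn1 : (1 : ℝ) ≤ n := (one_le_pow₀ (by norm_num)).trans hn2R
  refine ⟨C, hdepth, hsize.trans ?_, hres _ ?_, hbias.trans ?_⟩
  · rw [← Real.rpow_natCast]
    exact Real.rpow_le_rpow_of_exponent_le hn1 (by norm_num)
  · have hlog : (w : ℝ) / 2 ≤ Real.log n := by
      calc (w : ℝ) / 2 ≤ w * Real.log 2 := by nlinarith [Real.log_two_gt_d9]
        _ = Real.log (2 ^ w) := (Real.log_pow _ _).symm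
        _ ≤ _ := Real.log_le_log (by positivity) hn2R
    have hlog2 : (w : ℝ) ^ 2 / 4 ≤ Real.log n ^ 2 := by nlinarith
    rw [le_div_iff₀ (by linarith)]
    have huw : (2 : ℝ) ^ w * (1 / 2) ^ w = 1 := by rw [← mul_pow]; norm_num
    calc 816 * (1 / 2) ^ w * (n : ℝ) = 2448 * w ^ 2 * (2 ^ w * (1 / 2) ^ w) := by
          rw [hnR]; ring
      _ = 2448 * w ^ 2 := by rw [huw, mul_one]
      _ ≤ _ := by nlinarith
  · rw [add_zero, Real.rpow_neg_one, one_div, inv_pow]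
    gcongr
    have hww2 : (w : ℝ) ^ 2 ≤ 4 ^ w := by
      have : (w : ℝ) ≤ 2 ^ w := by exact_mod_cast (Nat.lt_two_pow_self (n := w)).le
      calc (w : ℝ) ^ 2 ≤ (2 ^ w) ^ 2 := by gcongr
        _ = 4 ^ w := by rw [← pow_mul, mul_comm, pow_mul]; norm_num
    have h2 : (3 : ℝ) ≤ 2 ^ w := by
      calc (3 : ℝ) ≤ 2 ^ 2 := by norm_num
        _ ≤ 2 ^ w := pow_le_pow_right₀ (by norm_num) hw2
    calc (n : ℝ) = 3 * w ^ 2 * 2 ^ w := hnR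
      _ ≤ 2 ^ w * 4 ^ w * 2 ^ w := by gcongr
      _ = 16 ^ w := by rw [← mul_pow, ← mul_pow]; norm_num
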